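/- Let $K$ be a finite extension of $\mathbb{Q}_2$ and let $E/K$ be an elliptic curve with additive, potentially good reduction and with $j(E)\neq 0$. Fix a Weierstrass equation of $E$ over $K$, let $c_4,c_6,\Delta\in K$ be its standard invariants (so that $c_4\neq 0$), let $L=K(E[3])$ be the field generated over $K$ by the coordinates of the $3$-torsion points of $E$ over an algebraic closure of $K$, and let $G=\mathrm{Gal}(L/K)$. Then $E[3]\cong\mathbb{F}_3^2$ and the action of $G$ on $E[3]$ gives an injective homomorphism $G\hookrightarrow \mathrm{GL}(2,\mathbb{F}_3)$. Let $\mu_3$ be the group of third roots of unity, and let $(\deg\gamma_i)_i$ be the degrees (an unordered list) of the irreducible factors over $K$ of $$\gamma(x)=x^8-6c_4x^4-8c_6x^2-3c_4^2=\prod_i\gamma_i(x).$$ According to whether $\mu_3\subset K$ and whether $\Delta$ is a cube in $K$, the list $(\deg\gamma_i)_i$ is one of the following, and $G$ is, up to isomorphism, the group given next to the list: - $\mu_3\subset K$, $\Delta\in K^{*3}$: one of $(2,2,2,2)$ and $G\cong C_2$; $(4,4)$ and $G\cong C_4$; $(8)$ and $G\cong Q_8$. - $\mu_3\subset K$, $\Delta\notin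 K^{*3}$: one of $(1,1,3,3)$ and $G\cong C_3$; $(2,6)$ and $G\cong C_6$; $(8)$ and $G\cong \mathrm{SL}(2,\mathbb{F}_3)$. - $\mu_3\not\subset K$, $\Delta\in K^{*3}$: one of $(2,2,4)$ and $G\cong C_2\times C_2$; $(4,4)$ and $G\cong D_8$; $(8)$ and ($G\cong C_8$ or $G\cong H_{16}$). - $\mu_3\not\subset K$, $\Delta\notin K^{*3}$: one of $(1,1,6)$ and $G\cong D_6$; $(2,3,3)$ and $G\cong D_6$; $(2,6)$ and $G\cong B_{12}$; $(8)$ and $G\cong \mathrm{GL}(2,\mathbb{F}_3)$. Here $C_n$ is the cyclic group of order $n$, $D_{2n}$ the dihedral group of order $2n$, $Q_8$ the quaternion group of order $8$, $B_{12}$ the Borel subgroup (upper triangular matrices) of $\mathrm{GL}(2,\mathbb{F}_3)$, and $H_{16}$ a Sylow $2$-subgroup of $\mathrm{GL}(2,\mathbb{F}_3)$. -/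

import Mathlib

open Polynomial

/-! ### Rings of integers of finite extensions of `ℚ_p`

The ring of integers of a finite extension `K` of `ℚ_p` is `integralClosure ℤ_[p] K`. The facts
below say that it is a discrete valuation ring with fraction field `K`, so that the reduction types
of a Weierstrass curve over `K` make sense. -/

theorem PadicInt.isIntegral_iff_spectralNorm_le_one (p : ℕ) [Fact p.Prime] (K : Type*) [Field K]
    [Algebra ℚ_[p] K] [Algebra ℤ_[p] K] [IsScalarTower ℤ_[p] ℚ_[p] K]
    [FiniteDimensional ℚ_[p] K] (x : K) :
    IsIntegral ℤ_[p] x ↔ spectralNorm ℚ_[p] K x ≤ 1 := by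
  have hx : IsIntegral ℚ_[p] x := Algebra.IsIntegral.isIntegral x
  rw [spectralNorm, spectralValue_le_one_iff (minpoly.monic hx)]
  constructor
  · intro h n
    rw [minpoly.isIntegrallyClosed_eq_field_fractions' ℚ_[p] h, coeff_map]
    exact PadicInt.norm_le_one _
  · intro h
    have hl : minpoly ℚ_[p] x ∈ Polynomial.lifts (algebraMap ℤ_[p] ℚ_[p]) := by
      rw [Polynomial.lifts_iff_coeff_lifts]
      exact fun n => ⟨⟨_, h n⟩, rfl⟩
    obtain ⟨q, hq, -, hm⟩ := Polynomial.lifts_and_degree_eq_and_monic hl (minpoly.monic hx)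
    refine ⟨q, hm, ?_⟩
    have := minpoly.aeval ℚ_[p] x
    rwa [← hq, aeval_map_algebraMap] at this

instance PadicInt.isFractionRing_integralClosure (p : ℕ) [Fact p.Prime] (K : Type*) [Field K]
    [Algebra ℚ_[p] K] [Algebra ℤ_[p] K] [IsScalarTower ℤ_[p] ℚ_[p] K]
    [FiniteDimensional ℚ_[p] K] : IsFractionRing (integralClosure ℤ_[p] K) K :=
  integralClosure.isFractionRing_of_finite_extension ℚ_[p] K

instance PadicInt.isDiscreteValuationRing_integralClosure (p : ℕ) [Fact p.Prime] (K : Type*)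
    [Field K] [Algebra ℚ_[p] K] [Algebra ℤ_[p] K] [IsScalarTower ℤ_[p] ℚ_[p] K]
    [FiniteDimensional ℚ_[p] K] : IsDiscreteValuationRing (integralClosure ℤ_[p] K) := by
  have hD : IsDedekindDomain (integralClosure ℤ_[p] K) :=
    integralClosure.isDedekindDomain ℤ_[p] ℚ_[p] K
  have hinj : Function.Injective (algebraMap ℤ_[p] K) := by
    rw [IsScalarTower.algebraMap_eq ℤ_[p] ℚ_[p] K]
    exact (algebraMap ℚ_[p] K).injective.comp (IsFractionRing.injective ℤ_[p] ℚ_[p])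
  have hmem : ∀ x : K, x ∈ integralClosure ℤ_[p] K ∨ x⁻¹ ∈ integralClosure ℤ_[p] K := by
    intro x
    simp only [mem_integralClosure_iff, PadicInt.isIntegral_iff_spectralNorm_le_one]
    by_cases h0 : x = 0
    · left; simp [h0, spectralNorm_zero]
    by_contra! hc
    have h1 := map_mul (spectralMulAlgNorm ℚ_[p] K) x x⁻¹
    rw [mul_inv_cancel₀ h0, map_one] at h1
    simp only [spectralMulAlgNorm_def] at h1
    nlinarith [hc.1, hc.2]
  have hV : ValuationRing (integralClosure ℤ_[p] K) := by
    rw [ValuationRing.iff_dvd_total]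
    refine ⟨fun a b => ?_⟩
    by_cases ha : a = 0
    · right; simp [ha]
    by_cases hb : b = 0
    · left; simp [hb]
    have ha' : (a : K) ≠ 0 := by simpa using ha
    have hb' : (b : K) ≠ 0 := by simpa using hb
    rcases hmem ((b : K) / a) with h | h
    · left
      exact ⟨⟨_, h⟩, Subtype.ext (by simp; field_simp)⟩
    · right
      exact ⟨⟨_, h⟩, Subtype.ext (by simp; field_simp)⟩
  have hF : ¬ IsField (integralClosure ℤ_[p] K) := by
    intro h
    refine IsDiscreteValuationRing.not_isField ℤ_[p] ?_
    have hinj' : Function.Injective (algebraMap ℤ_[p] (integralClosure ℤ_[p] K)) :=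
      fun a b hab => hinj (congrArg (algebraMap (integralClosure ℤ_[p] K) K) hab)
    exact isField_of_isIntegral_of_isField hinj' h
  exact ((IsDiscreteValuationRing.TFAE (integralClosure ℤ_[p] K) hF).out 0 1).mpr hV

/-! ### Reduction type of an elliptic curve over a finite extension of `ℚ_2` -/

namespace WeierstrassCurve

/-- The curve has additive reduction: some (equivalently, every) minimal Weierstrass equation of it
over the ring of integers of `K` has additive reduction. -/
def IsAdditive2 {K : Type*} [Field K] [Algebra ℚ_[2] K] [Algebra ℤ_[2] K]
    [IsScalarTower ℤ_[2] ℚ_[2] K] [FiniteDimensional ℚ_[2] K] (E : WeierstrassCurve K) : Prop :=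
  ∃ C : VariableChange K, (C • E).HasAdditiveReduction (integralClosure ℤ_[2] K)

/-- The curve has good reduction: some (equivalently, every) minimal Weierstrass equation of it
over the ring of integers of `K` has good reduction. -/
def IsGood2 {K : Type*} [Field K] [Algebra ℚ_[2] K] [Algebra ℤ_[2] K]
    [IsScalarTower ℤ_[2] ℚ_[2] K] [FiniteDimensional ℚ_[2] K] (E : WeierstrassCurve K) : Prop :=
  ∃ C : VariableChange K, (C • E).HasGoodReduction (integralClosure ℤ_[2] K)

theorem isScalarTower_intermediateField {K : Type*} [Field K] [Algebra ℚ_[2] K] [Algebra ℤ_[2] K]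
    [IsScalarTower ℤ_[2] ℚ_[2] K] (F : IntermediateField K (AlgebraicClosure K)) :
    IsScalarTower ℤ_[2] ℚ_[2] F := by
  refine IsScalarTower.of_algebraMap_eq fun x => ?_
  rw [IsScalarTower.algebraMap_apply ℤ_[2] K F, IsScalarTower.algebraMap_apply ℚ_[2] K F,
    IsScalarTower.algebraMap_apply ℤ_[2] ℚ_[2] K]

/-- The curve has potentially good reduction: it acquires good reduction over some finite extension
`F` of `K`. (As `K` is finite over `ℚ_2`, being finite over `K` and over `ℚ_2` are the same.) -/
def IsPotentiallyGood2 {K : Type*} [Field K] [Algebra ℚ_[2] K] [Algebra ℤ_[2] K]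
    [IsScalarTower ℤ_[2] ℚ_[2] K] (E : WeierstrassCurve K) : Prop :=
  ∃ (F : IntermediateField K (AlgebraicClosure K)) (_ : FiniteDimensional ℚ_[2] F),
    have := isScalarTower_intermediateField F
    (E.baseChange F).IsGood2

/-! ### The 3-division field and its Galois group -/

open scoped Classical in
/-- The group `E(F)[3]` of `F`-rational points of `E` killed by `3`. -/
noncomputable def threeTorsion {K : Type*} [Field K] (E : WeierstrassCurve K)
    (F : Type*) [Field F] [Algebra K F] : AddSubgroup (Affine.Point (E.baseChange F)) :=
  AddSubgroup.torsionBy (Affine.Point (E.baseChange F)) 3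

open scoped Classical in
/-- The field `L = K(E[3])` generated over `K` by the coordinates of all nonzero points of order
`3` of `E` over an algebraic closure of `K`. -/
noncomputable def threeDivisionField {K : Type*} [Field K] (E : WeierstrassCurve K) :
    IntermediateField K (AlgebraicClosure K) :=
  IntermediateField.adjoin K
    {t | ∃ (x y : AlgebraicClosure K)
      (h : (E.baseChange (AlgebraicClosure K)).toAffine.Nonsingular x y),
      Affine.Point.some x y h ∈ E.threeTorsion (AlgebraicClosure K) ∧ (t = x ∨ t = y)}

/-- The group `G = Gal(K(E[3])/K)`. -/
abbrev threeDivisionGroup {K : Type*} [Field K] (E : WeierstrassCurve K) : Type _ :=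
  E.threeDivisionField ≃ₐ[K] E.threeDivisionField

open scoped Classical in
/-- `ρ : G → GL(2, 𝔽₃)` is the matrix form, in the coordinates `φ : E[3] ≃ 𝔽₃²`, of the
coordinatewise action of `G = Gal(L/K)` on `E(L)[3]`, where `L = K(E[3])`. -/
def IsThreeTorsionRep {K : Type*} [Field K] (E : WeierstrassCurve K)
    (φ : E.threeTorsion E.threeDivisionField ≃+ (Fin 2 → ZMod 3))
    (ρ : E.threeDivisionGroup →* GL (Fin 2) (ZMod 3)) : Prop :=
  ∀ (σ : E.threeDivisionGroup) (P Q : E.threeTorsion E.threeDivisionField),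
    (Q : Affine.Point (E.baseChange E.threeDivisionField)) =
        Affine.Point.map (W' := E) (σ : E.threeDivisionField →ₐ[K] E.threeDivisionField) P.1 →
      φ Q = (ρ σ : Matrix (Fin 2) (Fin 2) (ZMod 3)).mulVec (φ P)

/-! ### The polynomial `γ` and the degrees of its factors -/

/-- `γ(x) = x⁸ - 6c₄x⁴ - 8c₆x² - 3c₄²`. -/
noncomputable def gammaPoly {K : Type*} [Field K] (E : WeierstrassCurve K) : K[X] :=
  X ^ 8 - C (6 * E.c₄) * X ^ 4 - C (8 * E.c₆) * X ^ 2 - C (3 * E.c₄ ^ 2)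

end WeierstrassCurve

/-- The multiset of degrees of the irreducible factors, with multiplicity, of a nonzero polynomial
over a field. -/
noncomputable def irreducibleFactorDegrees {K : Type*} [Field K] (f : K[X]) : Multiset ℕ :=
  (UniqueFactorizationMonoid.factors f).map natDegree

/-! ### The Borel subgroup of `GL(2, 𝔽₃)` -/

/-- The Borel subgroup of upper triangular matrices in `GL(2, 𝔽₃)`. -/
def borelGL2F3 : Subgroup (GL (Fin 2) (ZMod 3)) where
  carrier := {g | (g : Matrix (Fin 2) (Fin 2) (ZMod 3)) 1 0 = 0}
  mul_mem' := by
    intro a b ha hb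
    simp only [Set.mem_ofPred_eq] at ha hb ⊢
    simp [Matrix.mul_apply, Fin.sum_univ_two, ha, hb]
  one_mem' := by simp
  inv_mem' := by
    intro a ha
    simp only [Set.mem_ofPred_eq] at ha ⊢
    simp [Matrix.inv_def, Matrix.adjugate_fin_two, ha]

/-! A point of order three is a flex. If `l` is the slope of its tangent, then `s = 2l + a₁` is a
root of `γ` with `s² = 12x + b₂`, and the point is recovered rationally from `s`; this divides by
`s`, which is nonzero because `c₄ ≠ 0`. So the eight nonzero points of `E[3]` are,
Galois-equivariantly, the eight distinct roots of `γ`. Hence `L` is the splitting field of `γ`, and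
the degrees of the factors are the orbit sizes of the image `H` of `G` on the nonzero vectors of
`𝔽₃²` (`irreducibleFactorDegrees_eq_of_orbits`). It remains to see which `H` occur.

The squares of the roots are indexed by the four lines of `𝔽₃²`, and their three pairings give the
roots of a resolvent cubic. Shifted by `2c₄`, these are the three cube roots of `(-48)³Δ`
(`resolvent_roots`). Matrices of determinant `1` rotate them and matrices of determinant `-1`
reflect them. So `μ₃ ⊂ K` iff `H ⊂ SL(2, 𝔽₃)`, and `3 ∣ #H` iff `Δ` is not a cube
(`IsGammaParam.exists_isPrimitiveRoot_iff`, `IsGammaParam.three_dvd_card`,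
`IsGammaParam.rep_ne_unipotent`).

If `3 ∣ #H`, then up to conjugation `H` contains `matU`, and it either lies in the Borel subgroup or
contains `SL(2, 𝔽₃)`; every such group is in the lists. If `3 ∤ #H`, then `H` is a `2`-group, and
the lists omit exactly those fixing a nonzero vector: the trivial group and the group generated by a
reflection. Only here does the reduction type enter: a rational point of order three, a cube
discriminant and an integral `j` together give a model with unit discriminant, which additive
reduction forbids (`not_isGammaRoot_of_cube`). -/

/-! ### Three-torsion points and the roots of `γ` -/

namespace WeierstrassCurve

section Param

variable {F : Type*} [Field F] (W : WeierstrassCurve F)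

/-- The root of `γ` attached to a point `(x, y)` of order three. -/
noncomputable def gammaRoot (x y : F) : F :=
  ((12 * x + W.b₂) ^ 2 - W.c₄) / (24 * (2 * y + W.a₁ * x + W.a₃))

/-- The `x`-coordinate of the point of order three attached to a root of `γ`. -/
noncomputable def pointX (s : F) : F := (s ^ 2 - W.b₂) / 12

/-- The `y`-coordinate of the point of order three attached to a root of `γ`. -/
noncomputable def pointY (s : F) : F :=
  ((s ^ 4 - W.c₄) / (24 * s) - W.a₁ * W.pointX s - W.a₃) / 2

/-- The equation `γ(s) = 0`. -/
def IsGammaRoot (s : F) : Prop :=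
  s ^ 8 - 6 * W.c₄ * s ^ 4 - 8 * W.c₆ * s ^ 2 - 3 * W.c₄ ^ 2 = 0

theorem eval_gammaPoly (s : F) : W.gammaPoly.eval s = 0 ↔ W.IsGammaRoot s := by
  simp [gammaPoly, IsGammaRoot]

theorem two_y_sq {x y : F} (h : W.toAffine.Equation x y) :
    (2 * y + W.a₁ * x + W.a₃) ^ 2 = 4 * x ^ 3 + W.b₂ * x ^ 2 + 2 * W.b₄ * x + W.b₆ := by
  rw [Affine.equation_iff] at h
  simp only [b₂, b₄, b₆]
  linear_combination 4 * h

/-- In the variable `t = 12x + b₂` the two-division cubic and the three-division quartic are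
depressed, with coefficients in `c₄`, `c₆` only. The quartic at `t = s²` is `γ(s)`. -/
theorem cubic_shift (x : F) :
    (12 * x + W.b₂) ^ 3 - 3 * W.c₄ * (12 * x + W.b₂) - 2 * W.c₆ =
      432 * (4 * x ^ 3 + W.b₂ * x ^ 2 + 2 * W.b₄ * x + W.b₆) := by
  simp only [c₄, c₆]
  ring

theorem quartic_shift (x : F) :
    (12 * x + W.b₂) ^ 4 - 6 * W.c₄ * (12 * x + W.b₂) ^ 2 - 8 * W.c₆ * (12 * x + W.b₂)
      - 3 * W.c₄ ^ 2 =
      6912 * (3 * x ^ 4 + W.b₂ * x ^ 3 + 3 * W.b₄ * x ^ 2 + 3 * W.b₆ * x + W.b₈) := by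
  have h := W.b_relation
  simp only [c₄, c₆]
  linear_combination (-1728) * h

theorem map_gammaPoly {F' : Type*} [Field F'] (f : F →+* F') :
    W.gammaPoly.map f = (W.map f).gammaPoly := by
  simp only [gammaPoly, Polynomial.map_sub, Polynomial.map_mul, Polynomial.map_pow, map_X, map_C,
    Polynomial.map_ofNat, map_c₄, map_c₆, map_mul, map_pow, map_ofNat]

theorem derivative_gammaPoly : derivative W.gammaPoly =
    C 8 * X * (X ^ 6 - C (3 * W.c₄) * X ^ 2 - C (2 * W.c₆)) := by
  have e (a : F) : derivative (C a) = 0 := derivative_C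
  simp only [gammaPoly, derivative_sub, derivative_mul, derivative_X_pow, e, C_mul]
  simp only [map_natCast, map_ofNat]
  push_cast
  ring

variable [CharZero F] {W}

theorem c₄_cube_ne (hΔ : W.Δ ≠ 0) : W.c₄ ^ 3 ≠ W.c₆ ^ 2 := by
  intro h
  have := W.c_relation
  rw [h, sub_self] at this
  exact hΔ (by simpa using this)

/-- If `t` is a root of the quartic, then it is not a root of the cubic. -/
theorem cubic_ne_zero (hΔ : W.Δ ≠ 0) {t : F}
    (h : t ^ 4 - 6 * W.c₄ * t ^ 2 - 8 * W.c₆ * t - 3 * W.c₄ ^ 2 = 0) :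
    t ^ 3 - 3 * W.c₄ * t - 2 * W.c₆ ≠ 0 := by
  intro h3
  have h1 : (t ^ 2 - W.c₄) ^ 2 = 0 := by
    -- The identity `4t · cubic - quartic = 3(t² - c₄)²` governs the whole correspondence between
    -- points and roots.
    have : 3 * (t ^ 2 - W.c₄) ^ 2 = 0 := by linear_combination 4 * t * h3 - h
    simpa using this
  have h2 : t ^ 2 = W.c₄ := sub_eq_zero.mp (pow_eq_zero_iff (two_ne_zero) |>.mp h1)
  have h4 : W.c₆ = - W.c₄ * t := by
    have : 2 * (W.c₆ + W.c₄ * t) = 0 := by linear_combination t * h2 - h3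
    have := (mul_eq_zero.mp this).resolve_left two_ne_zero
    linear_combination this
  exact c₄_cube_ne hΔ (by rw [h4]; linear_combination (-W.c₄ ^ 2) * h2)

theorem IsGammaRoot.ne_zero (hc₄ : W.c₄ ≠ 0) {s : F} (hs : W.IsGammaRoot s) : s ≠ 0 := by
  rintro rfl
  simp [IsGammaRoot, hc₄] at hs

theorem IsGammaRoot.cubic_ne_zero (hΔ : W.Δ ≠ 0) {s : F} (hs : W.IsGammaRoot s) :
    s ^ 6 - 3 * W.c₄ * s ^ 2 - 2 * W.c₆ ≠ 0 := by
  have := WeierstrassCurve.cubic_ne_zero hΔ (t := s ^ 2)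
    (by unfold IsGammaRoot at hs; linear_combination hs)
  intro h
  exact this (by linear_combination h)

theorem IsGammaRoot.pow_four_ne (hΔ : W.Δ ≠ 0) (hc₄ : W.c₄ ≠ 0) {s : F} (hs : W.IsGammaRoot s) :
    s ^ 4 - W.c₄ ≠ 0 := by
  intro h
  have h1 := hs.cubic_ne_zero hΔ
  have h2 : 4 * s ^ 2 * (s ^ 6 - 3 * W.c₄ * s ^ 2 - 2 * W.c₆) = 0 := by
    unfold IsGammaRoot at hs
    linear_combination hs + 3 * (s ^ 4 - W.c₄) * h
  have := hs.ne_zero hc₄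
  simp_all

/-- Since `γ(s) = 4s² · cubic(s²) - 3(s⁴ - c₄)²`, a root of `γ` makes the cubic at `s²` equal to
`432` times the square of `(s⁴ - c₄) / (24s)`. -/
theorem equation_of_isGammaRoot (hc₄ : W.c₄ ≠ 0) {s : F} (hs : W.IsGammaRoot s) :
    W.toAffine.Equation (W.pointX s) (W.pointY s) := by
  have h0 := hs.ne_zero hc₄
  have hη : 2 * W.pointY s + W.a₁ * W.pointX s + W.a₃ = (s ^ 4 - W.c₄) / (24 * s) := by
    rw [pointY]; ring
  have hx : 12 * W.pointX s + W.b₂ = s ^ 2 := by rw [pointX]; ring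
  have h1 := W.cubic_shift (W.pointX s)
  rw [hx] at h1
  have h2 : 432 * (2 * W.pointY s + W.a₁ * W.pointX s + W.a₃) ^ 2 =
      (s ^ 2) ^ 3 - 3 * W.c₄ * s ^ 2 - 2 * W.c₆ := by
    rw [hη]
    field_simp
    unfold IsGammaRoot at hs
    linear_combination (-144) * hs
  rw [Affine.equation_iff]
  -- The `4` comes from completing the square in `y`, the `432` from `cubic_shift`.
  have h3 : (4 * 432 : F) ≠ 0 := by norm_num
  apply mul_left_cancel₀ h3
  have h4 := h2.trans h1
  simp only [b₂, b₄, b₆] at h4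
  linear_combination h4

variable [DecidableEq F]

omit [CharZero F] in
theorem two_y_ne_zero_of_torsion {x y : F} (h : W.toAffine.Nonsingular x y)
    (h3 : (3 : ℤ) • Affine.Point.some x y h = 0) :
    y ≠ W.toAffine.negY x y := by
  intro hy
  have h2 := Affine.Point.add_self_of_Y_eq (h₁ := h) hy
  rw [show (3 : ℤ) = 1 + 1 + 1 by norm_num, add_smul, add_smul, one_smul, h2, zero_add] at h3
  exact Affine.Point.some_ne_zero h h3

-- `3P = 0` means that the tangent at `P` meets the curve a third time at `P` itself, and the
-- difference of the two `x`-coordinates is the three-division polynomial up to sign and a nonzero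
-- square.
omit [CharZero F] in
theorem three_smul_some_iff {x y : F} (h : W.toAffine.Nonsingular x y)
    (hy : y ≠ W.toAffine.negY x y) :
    (3 : ℤ) • Affine.Point.some x y h = 0 ↔
      3 * x ^ 4 + W.b₂ * x ^ 3 + 3 * W.b₄ * x ^ 2 + 3 * W.b₆ * x + W.b₈ = 0 := by
  have e : (3 : ℤ) • Affine.Point.some x y h = 0 ↔
      Affine.Point.some x y h + Affine.Point.some x y h = - Affine.Point.some x y h := by
    rw [show (3 : ℤ) = 1 + 1 + 1 by norm_num, add_smul, add_smul, one_smul, add_eq_zero_iff_eq_neg]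
  rw [e, Affine.Point.add_self_of_Y_ne' hy, neg_inj, Affine.Point.some.injEq]
  have hη : y - W.toAffine.negY x y ≠ 0 := sub_ne_zero.mpr hy
  have hsl := W.toAffine.slope_of_Y_ne rfl hy
  set l := W.toAffine.slope x x y y
  have hl : l * (y - W.toAffine.negY x y) = 3 * x ^ 2 + 2 * W.a₂ * x + W.a₄ - W.a₁ * y := by
    rw [hsl]; field_simp
  have heq := (W.toAffine.equation_iff x y).mp h.1
  have key : (W.toAffine.addX x x l - x) * (y - W.toAffine.negY x y) ^ 2 =
      -(3 * x ^ 4 + W.b₂ * x ^ 3 + 3 * W.b₄ * x ^ 2 + 3 * W.b₆ * x + W.b₈) := by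
    have h1 : (W.toAffine.addX x x l - x) * (y - W.toAffine.negY x y) ^ 2 =
      (l * (y - W.toAffine.negY x y)) ^ 2
      + W.a₁ * (l * (y - W.toAffine.negY x y)) * (y - W.toAffine.negY x y)
      - (W.a₂ + 3 * x) * (y - W.toAffine.negY x y) ^ 2 := by
        simp only [Affine.addX]; ring
    rw [h1, hl]
    simp only [Affine.negY, b₂, b₄, b₆, b₈]
    linear_combination (-(12 * x + W.a₁ ^ 2 + 4 * W.a₂)) * heq
  constructor
  · rintro ⟨hx, -⟩
    rw [hx, sub_self, zero_mul] at key
    linear_combination key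
  · intro hΨ
    rw [hΨ, neg_zero] at key
    have hx : W.toAffine.addX x x l = x :=
      sub_eq_zero.mp ((mul_eq_zero.mp key).resolve_right (pow_ne_zero 2 hη))
    -- The third intersection lies on a non-vertical line through `P`, so equal `x` forces equal
    -- `y`.
    exact ⟨hx, by rw [Affine.negAddY, hx, sub_self, mul_zero, zero_add]⟩

omit [CharZero F] [DecidableEq F] in
theorem two_y_ne_zero_iff {x y : F} :
    y ≠ W.toAffine.negY x y ↔ 2 * y + W.a₁ * x + W.a₃ ≠ 0 := by
  rw [not_iff_not, Affine.negY, ← sub_eq_zero]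
  constructor <;> intro h <;> linear_combination h

omit [CharZero F] in
theorem quartic_of_torsion {x y : F} (h : W.toAffine.Nonsingular x y)
    (h3 : (3 : ℤ) • Affine.Point.some x y h = 0) :
    (12 * x + W.b₂) ^ 4 - 6 * W.c₄ * (12 * x + W.b₂) ^ 2 - 8 * W.c₆ * (12 * x + W.b₂)
      - 3 * W.c₄ ^ 2 = 0 := by
  rw [quartic_shift,
    (three_smul_some_iff h (two_y_ne_zero_of_torsion h h3)).mp h3, mul_zero]

theorem gammaRoot_sq {x y : F} (h : W.toAffine.Nonsingular x y)
    (h3 : (3 : ℤ) • Affine.Point.some x y h = 0) :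
    W.gammaRoot x y ^ 2 = 12 * x + W.b₂ := by
  have hη := two_y_ne_zero_iff.mp (two_y_ne_zero_of_torsion h h3)
  have h4 := quartic_of_torsion h h3
  have h5 := W.cubic_shift x
  rw [← W.two_y_sq h.1] at h5
  rw [gammaRoot, div_pow, div_eq_iff (pow_ne_zero 2 (mul_ne_zero (by norm_num) hη))]
  linear_combination (4 / 3 * (12 * x + W.b₂)) * h5 - h4 / 3

theorem isGammaRoot_gammaRoot {x y : F} (h : W.toAffine.Nonsingular x y)
    (h3 : (3 : ℤ) • Affine.Point.some x y h = 0) :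
    W.IsGammaRoot (W.gammaRoot x y) := by
  have h4 := quartic_of_torsion h h3
  rw [← gammaRoot_sq h h3] at h4
  unfold IsGammaRoot
  linear_combination h4

theorem pointX_gammaRoot {x y : F} (h : W.toAffine.Nonsingular x y)
    (h3 : (3 : ℤ) • Affine.Point.some x y h = 0) : W.pointX (W.gammaRoot x y) = x := by
  rw [pointX, gammaRoot_sq h h3]; ring

theorem pointY_gammaRoot (hc₄ : W.c₄ ≠ 0)
    {x y : F} (h : W.toAffine.Nonsingular x y)
    (h3 : (3 : ℤ) • Affine.Point.some x y h = 0) : W.pointY (W.gammaRoot x y) = y := by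
  have hη := two_y_ne_zero_iff.mp (two_y_ne_zero_of_torsion h h3)
  have hs := isGammaRoot_gammaRoot h h3
  have h1 : (W.gammaRoot x y ^ 4 - W.c₄) = 24 * W.gammaRoot x y * (2 * y + W.a₁ * x + W.a₃) := by
    rw [show W.gammaRoot x y ^ 4 = (W.gammaRoot x y ^ 2) ^ 2 by ring, gammaRoot_sq h h3, gammaRoot]
    generalize 2 * y + W.a₁ * x + W.a₃ = η at *
    field_simp
  have := hs.ne_zero hc₄
  rw [pointY, pointX_gammaRoot h h3, h1]
  field_simp
  ring

omit [DecidableEq F] in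
theorem gammaRoot_point (hΔ : W.Δ ≠ 0) (hc₄ : W.c₄ ≠ 0) {s : F} (hs : W.IsGammaRoot s) :
    W.gammaRoot (W.pointX s) (W.pointY s) = s := by
  have h0 := hs.ne_zero hc₄
  have h4 := hs.pow_four_ne hΔ hc₄
  have hη : 2 * W.pointY s + W.a₁ * W.pointX s + W.a₃ = (s ^ 4 - W.c₄) / (24 * s) := by
    rw [pointY]; ring
  have hx : 12 * W.pointX s + W.b₂ = s ^ 2 := by rw [pointX]; ring
  rw [gammaRoot, hη, hx, ← pow_mul]
  field_simp

theorem three_smul_point (hΔ : W.Δ ≠ 0) (hc₄ : W.c₄ ≠ 0) {s : F} (hs : W.IsGammaRoot s)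
    (h : W.toAffine.Nonsingular (W.pointX s) (W.pointY s)) :
    (3 : ℤ) • Affine.Point.some _ _ h = 0 := by
  have h0 := hs.ne_zero hc₄
  have h4 := hs.pow_four_ne hΔ hc₄
  have hη : 2 * W.pointY s + W.a₁ * W.pointX s + W.a₃ = (s ^ 4 - W.c₄) / (24 * s) := by
    rw [pointY]; ring
  have hx : 12 * W.pointX s + W.b₂ = s ^ 2 := by rw [pointX]; ring
  rw [three_smul_some_iff h (two_y_ne_zero_iff.mpr (by rw [hη]; exact div_ne_zero h4 (mul_ne_zero (by norm_num) h0)))]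
  have := W.quartic_shift (W.pointX s)
  rw [hx] at this
  unfold IsGammaRoot at hs
  have h6 : (6912 : F) ≠ 0 := by norm_num
  apply (mul_eq_zero.mp (this.symm.trans _)).resolve_left h6
  linear_combination hs

-- A multiple root would be `0` or have its square on both the quartic and the cubic; `c₄ ≠ 0` and
-- `Δ ≠ 0` exclude these.
omit [DecidableEq F] in
theorem gammaPoly_separable (hΔ : W.Δ ≠ 0) (hc₄ : W.c₄ ≠ 0) : W.gammaPoly.Separable := by
  rw [Separable, isCoprime_iff_aeval_ne_zero_of_isAlgClosed F (AlgebraicClosure F)]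
  intro s
  by_contra! h
  obtain ⟨h1, h2⟩ := h
  set W' := W.map (algebraMap F (AlgebraicClosure F)) with hW'
  rw [aeval_def, ← eval_map, map_gammaPoly, ← hW', eval_gammaPoly] at h1
  rw [aeval_def, ← eval_map, ← derivative_map, map_gammaPoly, ← hW', derivative_gammaPoly] at h2
  have hΔ' : W'.Δ ≠ 0 := by rwa [map_Δ, _root_.map_ne_zero]
  have hc₄' : W'.c₄ ≠ 0 := by rwa [map_c₄, _root_.map_ne_zero]
  have := h1.ne_zero hc₄'
  have := h1.cubic_ne_zero hΔ'
  simp_all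

end Param

end WeierstrassCurve

/-! ### Factor degrees and Galois orbits -/

theorem minpoly_map_eq_prod_of_orbit {K L : Type*} [Field K] [Field L] [Algebra K L]
    [FiniteDimensional K L] [IsGalois K L] (x : L) (O : Finset L)
    (hO : ∀ y, y ∈ O ↔ ∃ σ : L ≃ₐ[K] L, σ x = y) :
    (minpoly K x).map (algebraMap K L) = (O.val.map fun a => X - C a).prod := by
  have hs : ((minpoly K x).map (algebraMap K L)).Splits := Normal.splits inferInstance x
  have hint : IsIntegral K x := Algebra.IsIntegral.isIntegral x
  have hmon : ((minpoly K x).map (algebraMap K L)).Monic := (minpoly.monic hint).map _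
  have hr : ((minpoly K x).map (algebraMap K L)).roots = O.val := by
    have hsep : ((minpoly K x).map (algebraMap K L)).Separable :=
      Separable.map (Algebra.IsSeparable.isSeparable K x)
    refine (Multiset.Nodup.ext (nodup_roots hsep) O.nodup).mpr fun y => ?_
    rw [mem_roots hmon.ne_zero, Finset.mem_val, hO, IsRoot.def, eval_map, ← aeval_def]
    constructor
    · intro h
      have h1 := minpoly.eq_of_irreducible_of_monic (minpoly.irreducible hint) h (minpoly.monic hint)
      obtain ⟨σ, hσ⟩ := (Normal.minpoly_eq_iff_mem_orbit (F := K) (E := L)).mp h1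
      exact ⟨σ⁻¹, by rw [← hσ]; exact σ.symm_apply_apply y⟩
    · rintro ⟨σ, rfl⟩
      have := minpoly.aeval K (σ x)
      rwa [minpoly.algEquiv_eq] at this
  rw [← hr]
  exact hs.eq_prod_roots_of_monic hmon

/-- Each orbit contributes the minimal polynomial of one of its elements, of degree the orbit size.
Their product is `f` after extension to `L`, hence over `K`, and factorisation is unique. -/
theorem irreducibleFactorDegrees_eq_of_orbits {K L : Type*} [Field K] [Field L] [Algebra K L]
    [FiniteDimensional K L] [IsGalois K L] {f : K[X]} (hf : f.Monic)
    (hsplit : (f.map (algebraMap K L)).Splits) (P : Multiset (Finset L))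
    (hP : ∀ O ∈ P, ∃ x, ∀ y, y ∈ O ↔ ∃ σ : L ≃ₐ[K] L, σ x = y)
    (hsum : (P.map Finset.val).sum = (f.map (algebraMap K L)).roots) :
    irreducibleFactorDegrees f = P.map Finset.card := by
  classical
  have hg : ∀ O : Finset L, ∃ p : K[X], O ∈ P → Irreducible p ∧ p.natDegree = O.card ∧
      p.map (algebraMap K L) = (O.val.map fun a => X - C a).prod := by
    intro O
    by_cases hO : O ∈ P
    · obtain ⟨x, hx⟩ := hP O hO
      have h := minpoly_map_eq_prod_of_orbit x O hx
      refine ⟨minpoly K x, fun _ => ⟨minpoly.irreducible (Algebra.IsIntegral.isIntegral x), ?_, h⟩⟩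
      rw [← natDegree_map (algebraMap K L), h, natDegree_multiset_prod_X_sub_C_eq_card]
      rfl
    · exact ⟨0, fun h => absurd h hO⟩
  choose g hg using hg
  have hprod : (P.map g).prod = f := by
    apply map_injective _ (algebraMap K L).injective
    rw [hsplit.eq_prod_roots_of_monic (hf.map _), ← hsum, Polynomial.map_multiset_prod,
      Multiset.map_map]
    have : ∀ Q : Multiset (Finset L), (∀ O ∈ Q, O ∈ P) →
        (Q.map (Polynomial.map (algebraMap K L) ∘ g)).prod =
          (((Q.map Finset.val).sum).map fun a => X - C a).prod := by
      intro Q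
      induction Q using Multiset.induction with
      | empty => simp
      | cons O Q ih =>
        intro h
        simp only [Multiset.map_cons, Multiset.prod_cons, Multiset.sum_cons, Multiset.map_add,
          Multiset.prod_add, Function.comp_apply]
        rw [(hg O (h O (by simp))).2.2, ← ih fun O' h' => h O' (by simp [h'])]
        rfl
    exact this P fun _ h => h
  have hrel := UniqueFactorizationMonoid.factors_unique
    (f := UniqueFactorizationMonoid.factors f) (g := P.map g)
    (fun x hx => UniqueFactorizationMonoid.irreducible_of_factor x hx)
    (fun x hx => by
      obtain ⟨O, hO, rfl⟩ := Multiset.mem_map.mp hx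
      exact (hg O hO).1)
    (by rw [hprod]; exact UniqueFactorizationMonoid.factors_prod hf.ne_zero)
  have h2 : (UniqueFactorizationMonoid.factors f).map natDegree = (P.map g).map natDegree := by
    rw [← Multiset.rel_eq, Multiset.rel_map]
    exact hrel.mono fun a _ b _ hab => natDegree_eq_of_degree_eq (degree_eq_degree_of_associated hab)
  rw [irreducibleFactorDegrees, h2, Multiset.map_map]
  exact Multiset.map_congr rfl fun O hO => (hg O hO).2.1

namespace WeierstrassCurve

/-! ### The three-division field as a splitting field -/

section TorsRoot

variable {F : Type*} [Field F] {W : WeierstrassCurve F}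

/-- The root of `γ` attached to a three-torsion point, with value `0` at the origin. -/
noncomputable def torsRoot : W.toAffine.Point → F
  | 0 => 0
  | .some x y _ => W.gammaRoot x y

@[simp] theorem torsRoot_zero : torsRoot (0 : W.toAffine.Point) = 0 := rfl

@[simp] theorem torsRoot_some {x y : F} (h : W.toAffine.Nonsingular x y) :
    torsRoot (Affine.Point.some x y h) = W.gammaRoot x y := rfl

theorem torsRoot_neg (P : W.toAffine.Point) : torsRoot (-P) = -torsRoot P := by
  rcases P with _ | ⟨x, y, h⟩
  · simp [← Affine.Point.zero_def]
  · rw [Affine.Point.neg_some, torsRoot_some, torsRoot_some, gammaRoot, gammaRoot, ← div_neg]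
    congr 1
    simp only [Affine.negY]
    ring

variable [CharZero F] [DecidableEq F]

theorem isGammaRoot_torsRoot {P : W.toAffine.Point} (h0 : P ≠ 0) (h3 : (3 : ℤ) • P = 0) :
    W.IsGammaRoot (torsRoot P) := by
  rcases P with _ | ⟨x, y, h⟩
  · exact absurd rfl h0
  · exact isGammaRoot_gammaRoot h h3

theorem torsRoot_injOn (hc₄ : W.c₄ ≠ 0) {P Q : W.toAffine.Point} (hP0 : P ≠ 0) (hQ0 : Q ≠ 0)
    (hP : (3 : ℤ) • P = 0) (hQ : (3 : ℤ) • Q = 0) (h : torsRoot P = torsRoot Q) : P = Q := by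
  rcases P with _ | ⟨x, y, hxy⟩
  · exact absurd rfl hP0
  rcases Q with _ | ⟨x', y', hxy'⟩
  · exact absurd rfl hQ0
  simp only [torsRoot_some] at h
  have h1 := pointX_gammaRoot hxy hP
  have h2 := pointY_gammaRoot hc₄ hxy hP
  rw [h, pointX_gammaRoot hxy' hQ] at h1
  rw [h, pointY_gammaRoot hc₄ hxy' hQ] at h2
  subst h1 h2
  rfl

theorem exists_torsRoot (hΔ : W.Δ ≠ 0) (hc₄ : W.c₄ ≠ 0) {s : F} (hs : W.IsGammaRoot s) :
    ∃ P : W.toAffine.Point, P ≠ 0 ∧ (3 : ℤ) • P = 0 ∧ torsRoot P = s := by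
  have h := (W.toAffine.equation_iff_nonsingular_of_Δ_ne_zero hΔ).mp
    (equation_of_isGammaRoot hc₄ hs)
  exact ⟨.some _ _ h, Affine.Point.some_ne_zero h, three_smul_point hΔ hc₄ hs h,
    gammaRoot_point hΔ hc₄ hs⟩

end TorsRoot

section DivisionField

variable {K : Type*} [Field K] (E : WeierstrassCurve K)

open scoped Classical in
theorem mem_threeTorsion {F : Type*} [Field F] [Algebra K F]
    {P : Affine.Point (E.baseChange F)} : P ∈ E.threeTorsion F ↔ (3 : ℤ) • P = 0 := by
  rfl

open scoped Classical in
theorem torsRoot_map {F : Type*} [Field F] [Algebra K F] (σ : F →ₐ[K] F)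
    (P : Affine.Point (E.baseChange F)) :
    torsRoot (Affine.Point.map (W' := E) σ P) = σ (torsRoot P) := by
  rcases P with _ | ⟨x, y, h⟩
  · simp [← Affine.Point.zero_def]
  · rw [Affine.Point.map_some, torsRoot_some, torsRoot_some]
    simp only [gammaRoot, baseChange, map_b₂, map_c₄, map_a₁, map_a₃, map_div₀, map_sub, map_pow,
      map_add, map_mul, map_ofNat, AlgHom.commutes]

variable {E} [CharZero K]

/-- The coordinates of the points and the roots of `γ` are rational functions of each other over
`K`. -/
theorem threeDivisionField_eq_adjoin (hΔ : E.Δ ≠ 0) (hc₄ : E.c₄ ≠ 0) :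
    E.threeDivisionField =
      IntermediateField.adjoin K (E.gammaPoly.rootSet (AlgebraicClosure K)) := by
  classical
  set Kb := AlgebraicClosure K
  set W := E.baseChange Kb with hW
  have hΔ' : W.Δ ≠ 0 := by rwa [hW, baseChange, map_Δ, _root_.map_ne_zero]
  have hc₄' : W.c₄ ≠ 0 := by rwa [hW, baseChange, map_c₄, _root_.map_ne_zero]
  have hmem : ∀ s : Kb, s ∈ E.gammaPoly.rootSet Kb ↔ W.IsGammaRoot s := by
    intro s
    have hm : E.gammaPoly ≠ 0 := (gammaPoly_separable hΔ hc₄).ne_zero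
    rw [mem_rootSet_of_ne hm, aeval_def, ← eval_map, map_gammaPoly, eval_gammaPoly]
    rfl
  have hb₂ (M : IntermediateField K Kb) : W.b₂ ∈ M := by
    rw [hW, baseChange, map_b₂]; exact M.algebraMap_mem _
  have hc₄M (M : IntermediateField K Kb) : W.c₄ ∈ M := by
    rw [hW, baseChange, map_c₄]; exact M.algebraMap_mem _
  have ha₁ (M : IntermediateField K Kb) : W.a₁ ∈ M := by
    rw [hW, baseChange, map_a₁]; exact M.algebraMap_mem _
  have ha₃ (M : IntermediateField K Kb) : W.a₃ ∈ M := by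
    rw [hW, baseChange, map_a₃]; exact M.algebraMap_mem _
  have hn (M : IntermediateField K Kb) (n : ℕ) [n.AtLeastTwo] :
    (ofNat(n) : Kb) ∈ M := ofNat_mem M n
  apply le_antisymm
  · rw [threeDivisionField, IntermediateField.adjoin_le_iff]
    set M := IntermediateField.adjoin K (E.gammaPoly.rootSet Kb)
    rintro t ⟨x, y, h, h3, ht⟩
    have hr : W.gammaRoot x y ∈ M :=
      IntermediateField.subset_adjoin _ _ ((hmem _).mpr (isGammaRoot_gammaRoot h h3))
    have hx : W.pointX (W.gammaRoot x y) ∈ M :=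
      M.div_mem (M.sub_mem (pow_mem hr 2) (hb₂ M)) (hn M 12)
    have hy : W.pointY (W.gammaRoot x y) ∈ M :=
      M.div_mem (M.sub_mem (M.sub_mem (M.div_mem (M.sub_mem (pow_mem hr 4) (hc₄M M))
        (M.mul_mem (hn M 24) hr)) (M.mul_mem (ha₁ M) hx)) (ha₃ M)) (hn M 2)
    rw [pointX_gammaRoot h h3] at hx
    rw [pointY_gammaRoot hc₄' h h3] at hy
    rcases ht with rfl | rfl
    exacts [hx, hy]
  · rw [IntermediateField.adjoin_le_iff]
    intro s hs
    rw [hmem] at hs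
    have h := (W.toAffine.equation_iff_nonsingular_of_Δ_ne_zero hΔ').mp
      (equation_of_isGammaRoot hc₄' hs)
    have h3 := three_smul_point hΔ' hc₄' hs h
    set M := E.threeDivisionField
    have hx : W.pointX s ∈ M :=
      IntermediateField.subset_adjoin _ _ ⟨_, _, h, h3, Or.inl rfl⟩
    have hy : W.pointY s ∈ M :=
      IntermediateField.subset_adjoin _ _ ⟨_, _, h, h3, Or.inr rfl⟩
    rw [← gammaRoot_point hΔ' hc₄' hs]
    exact M.div_mem (M.sub_mem (pow_mem (M.add_mem (M.mul_mem (hn M 12) hx) (hb₂ M)) 2) (hc₄M M))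
      (M.mul_mem (hn M 24) (M.add_mem (M.add_mem (M.mul_mem (hn M 2) hy)
        (M.mul_mem (ha₁ M) hx)) (ha₃ M)))

theorem isSplittingField_threeDivisionField (hΔ : E.Δ ≠ 0) (hc₄ : E.c₄ ≠ 0) :
    E.gammaPoly.IsSplittingField K E.threeDivisionField := by
  rw [threeDivisionField_eq_adjoin hΔ hc₄]
  exact IntermediateField.adjoin_rootSet_isSplittingField (IsAlgClosed.splits _)

theorem finiteDimensional_threeDivisionField (hΔ : E.Δ ≠ 0) (hc₄ : E.c₄ ≠ 0) :
    FiniteDimensional K E.threeDivisionField :=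
  have := isSplittingField_threeDivisionField hΔ hc₄
  IsSplittingField.finiteDimensional _ E.gammaPoly

theorem isGalois_threeDivisionField (hΔ : E.Δ ≠ 0) (hc₄ : E.c₄ ≠ 0) :
    IsGalois K E.threeDivisionField :=
  have := isSplittingField_threeDivisionField hΔ hc₄
  IsGalois.of_separable_splitting_field (gammaPoly_separable hΔ hc₄)

omit [CharZero K] in
theorem monic_gammaPoly : E.gammaPoly.Monic := by
  rw [gammaPoly, sub_sub, sub_sub]
  monicity!

omit [CharZero K] in
theorem natDegree_gammaPoly : E.gammaPoly.natDegree = 8 := by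
  rw [gammaPoly]
  compute_degree!

omit [CharZero K] in
theorem mem_rootSet_gammaPoly {F : Type*} [Field F] [Algebra K F] (s : F) :
    s ∈ E.gammaPoly.rootSet F ↔ (E.baseChange F).IsGammaRoot s := by
  rw [mem_rootSet_of_ne monic_gammaPoly.ne_zero, aeval_def, ← eval_map, map_gammaPoly,
    eval_gammaPoly]
  rfl

theorem card_threeTorsion {L : Type*} [Field L] [Algebra K L] [CharZero L]
    (hsplit : (E.gammaPoly.map (algebraMap K L)).Splits) (hΔ : E.Δ ≠ 0) (hc₄ : E.c₄ ≠ 0) :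
    Nat.card (E.threeTorsion L) = 9 := by
  classical
  set W := E.baseChange L with hW
  have hΔ' : W.Δ ≠ 0 := by rwa [hW, baseChange, map_Δ, _root_.map_ne_zero]
  have hc₄' : W.c₄ ≠ 0 := by rwa [hW, baseChange, map_c₄, _root_.map_ne_zero]
  let f : {P : E.threeTorsion L // P ≠ 0} → E.gammaPoly.rootSet L := fun P =>
    ⟨torsRoot P.1.1, (mem_rootSet_gammaPoly _).mpr
      (isGammaRoot_torsRoot (fun h => P.2 (Subtype.ext h)) P.1.2)⟩
  have hf : Function.Bijective f := by
    constructor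
    · intro P Q h
      exact Subtype.ext <| Subtype.ext <| torsRoot_injOn hc₄' (fun h => P.2 (Subtype.ext h))
        (fun h => Q.2 (Subtype.ext h)) P.1.2 Q.1.2 (congrArg Subtype.val h)
    · rintro ⟨s, hs⟩
      obtain ⟨P, h0, h3, hP⟩ := exists_torsRoot hΔ' hc₄' ((mem_rootSet_gammaPoly _).mp hs)
      exact ⟨⟨⟨P, h3⟩, fun h => h0 (congrArg Subtype.val h)⟩, Subtype.ext hP⟩
  -- The extra element of `Option` is the origin: `9 = 8 + 1`.
  rw [← Nat.card_congr (Equiv.optionSubtypeNe (0 : E.threeTorsion L)),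
    Nat.card_congr (Equiv.optionCongr (Equiv.ofBijective f hf)), Nat.card_eq_fintype_card,
    Fintype.card_option, card_rootSet_eq_natDegree (gammaPoly_separable hΔ hc₄) hsplit,
    natDegree_gammaPoly]

end DivisionField

end WeierstrassCurve

namespace WeierstrassCurve

/-! ### The representation on three-torsion -/

/-- The vectors of `𝔽₃²` parametrise the roots of `γ` in `L`, compatibly with the Galois action
through `ρ`. -/
structure IsGammaParam {K : Type*} [Field K] (E : WeierstrassCurve K) {L : Type*} [Field L]
    [Algebra K L] (ρ : (L ≃ₐ[K] L) →* GL (Fin 2) (ZMod 3)) (s : (Fin 2 → ZMod 3) → L) : Prop where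
  isGammaRoot : ∀ v, v ≠ 0 → (E.baseChange L).IsGammaRoot (s v)
  injOn : ∀ v w, v ≠ 0 → w ≠ 0 → s v = s w → v = w
  surj : ∀ r, (E.baseChange L).IsGammaRoot r → ∃ v, v ≠ 0 ∧ s v = r
  neg : ∀ v, s (-v) = -s v
  equivariant : ∀ σ v, σ (s v) = s ((ρ σ : Matrix (Fin 2) (Fin 2) (ZMod 3)).mulVec v)

/-- Change of basis of `𝔽₃²`. It allows a chosen element of the image to be put in normal form,
while everything later depends on the parametrisation alone. -/
theorem IsGammaParam.conj {K : Type*} [Field K] {E : WeierstrassCurve K} {L : Type*} [Field L]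
    [Algebra K L] {ρ : (L ≃ₐ[K] L) →* GL (Fin 2) (ZMod 3)} {s : (Fin 2 → ZMod 3) → L}
    (h : E.IsGammaParam ρ s) (g : GL (Fin 2) (ZMod 3)) :
    E.IsGammaParam ((MulAut.conj g).toMonoidHom.comp ρ)
      (fun v => s ((g⁻¹ : GL (Fin 2) (ZMod 3)).1.mulVec v)) := by
  have hg : ∀ v, g.1.mulVec ((g⁻¹ : GL (Fin 2) (ZMod 3)).1.mulVec v) = v := fun v => by
    rw [Matrix.mulVec_mulVec, ← Units.val_mul, mul_inv_cancel, Units.val_one, Matrix.one_mulVec]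
  have hg' : ∀ v, (g⁻¹ : GL (Fin 2) (ZMod 3)).1.mulVec (g.1.mulVec v) = v := fun v => by
    rw [Matrix.mulVec_mulVec, ← Units.val_mul, inv_mul_cancel, Units.val_one, Matrix.one_mulVec]
  have h0 : ∀ v, v ≠ 0 → (g⁻¹ : GL (Fin 2) (ZMod 3)).1.mulVec v ≠ 0 := fun v hv hv' => by
    have := hg v
    rw [hv', Matrix.mulVec_zero] at this
    exact hv this.symm
  refine ⟨fun v hv => h.isGammaRoot _ (h0 v hv), fun v w hv hw hvw => ?_, fun r hr => ?_,
    fun v => ?_, fun σ v => ?_⟩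
  · rw [← hg v, h.injOn _ _ (h0 v hv) (h0 w hw) hvw, hg w]
  · obtain ⟨v, hv, rfl⟩ := h.surj r hr
    refine ⟨g.1.mulVec v, fun hv' => hv ?_, by rw [hg']⟩
    rw [← hg' v, hv', Matrix.mulVec_zero]
  · rw [Matrix.mulVec_neg, h.neg]
  · rw [h.equivariant]
    congr 1
    simp only [MonoidHom.coe_comp, Function.comp_apply, MulEquiv.coe_toMonoidHom,
      MulAut.conj_apply, Units.val_mul, Matrix.mulVec_mulVec]
    rw [← mul_assoc, ← mul_assoc, ← Units.val_mul g⁻¹ g, inv_mul_cancel, Units.val_one, one_mul]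

section Rep

variable {K : Type*} [Field K] {E : WeierstrassCurve K} {L : Type*} [Field L] [Algebra K L]

theorem exists_coords [CharZero K] [CharZero L]
    (hsplit : (E.gammaPoly.map (algebraMap K L)).Splits) (hΔ : E.Δ ≠ 0) (hc₄ : E.c₄ ≠ 0) :
    Nonempty (E.threeTorsion L ≃+ (Fin 2 → ZMod 3)) := by
  classical
  have hcard := card_threeTorsion hsplit hΔ hc₄
  let _ : Module (ZMod 3) (E.threeTorsion L) := AddCommGroup.zmodModule fun P => by
    have h := P.2
    rw [mem_threeTorsion] at h
    apply Subtype.ext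
    rw [AddSubgroup.coe_nsmul, AddSubgroup.coe_zero, ← h]
    exact (natCast_zsmul _ 3).symm
  have : Finite (E.threeTorsion L) := Nat.finite_of_card_ne_zero (by rw [hcard]; norm_num)
  have : Module.Finite (ZMod 3) (E.threeTorsion L) := Module.Finite.of_finite
  have hrank : Module.finrank (ZMod 3) (E.threeTorsion L) = 2 := by
    have h := Module.natCard_eq_pow_finrank (K := ZMod 3) (V := E.threeTorsion L)
    rw [hcard, Nat.card_zmod] at h
    exact (Nat.pow_right_injective (Nat.le_succ_of_le (le_refl 2)) |>.eq_iff.mp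
      (show 3 ^ 2 = 3 ^ _ from by rw [← h])).symm
  exact ⟨((Module.finBasisOfFinrankEq (ZMod 3) _ hrank).equivFun).toAddEquiv⟩

open scoped Classical in
/-- The Galois action on three-torsion points. -/
noncomputable def torsionHom (E : WeierstrassCurve K) (σ : L ≃ₐ[K] L) :
    E.threeTorsion L →+ E.threeTorsion L :=
  ((Affine.Point.map (W' := E) (σ : L →ₐ[K] L)).comp (E.threeTorsion L).subtype).codRestrict
    (E.threeTorsion L) fun P => by
      have h := P.2
      rw [mem_threeTorsion] at h ⊢
      rw [AddMonoidHom.comp_apply, ← map_zsmul, AddSubgroup.coe_subtype, h, map_zero]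

open scoped Classical in
theorem coe_torsionHom (σ : L ≃ₐ[K] L) (P : E.threeTorsion L) :
    (E.torsionHom σ P : Affine.Point (E.baseChange L)) =
      Affine.Point.map (W' := E) (σ : L →ₐ[K] L) P.1 := rfl

theorem torsionHom_one (P : E.threeTorsion L) : E.torsionHom (1 : L ≃ₐ[K] L) P = P := by
  apply Subtype.ext
  rw [coe_torsionHom]
  rcases P.1 with _ | ⟨x, y, h⟩ <;> rfl

theorem torsionHom_mul (σ τ : L ≃ₐ[K] L) (P : E.threeTorsion L) :
    E.torsionHom (σ * τ) P = E.torsionHom σ (E.torsionHom τ P) := by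
  apply Subtype.ext
  rw [coe_torsionHom, coe_torsionHom, coe_torsionHom]
  rcases P.1 with _ | ⟨x, y, h⟩ <;> rfl

/-- The matrix representation on three-torsion in the coordinates `φ`. -/
noncomputable def torsionRep (φ : E.threeTorsion L ≃+ (Fin 2 → ZMod 3)) :
    (L ≃ₐ[K] L) →* GL (Fin 2) (ZMod 3) :=
  MonoidHom.toHomUnits
    { toFun := fun σ => LinearMap.toMatrix' (AddMonoidHom.toZModLinearMap 3
        ((φ : E.threeTorsion L →+ _).comp ((E.torsionHom σ).comp (φ.symm : _ →+ _))))
      map_one' := by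
        rw [← LinearMap.toMatrix'_one]
        congr 1
        ext v i
        simp [torsionHom_one]
      map_mul' := fun σ τ => by
        rw [← LinearMap.toMatrix'_mul]
        congr 1
        ext v i
        simp [torsionHom_mul] }

theorem torsionRep_mulVec (φ : E.threeTorsion L ≃+ (Fin 2 → ZMod 3)) (σ : L ≃ₐ[K] L)
    (P : E.threeTorsion L) :
    (torsionRep φ σ : Matrix (Fin 2) (Fin 2) (ZMod 3)).mulVec (φ P) = φ (E.torsionHom σ P) := by
  simp only [torsionRep, MonoidHom.coe_toHomUnits, MonoidHom.coe_mk, OneHom.coe_mk]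
  rw [LinearMap.toMatrix'_mulVec]
  simp

theorem isGammaParam_torsionRep [CharZero L] (hΔ : E.Δ ≠ 0) (hc₄ : E.c₄ ≠ 0)
    (φ : E.threeTorsion L ≃+ (Fin 2 → ZMod 3)) :
    E.IsGammaParam (torsionRep φ) fun v => torsRoot (φ.symm v).1 := by
  classical
  set W := E.baseChange L with hW
  have hΔ' : W.Δ ≠ 0 := by rwa [hW, baseChange, map_Δ, _root_.map_ne_zero]
  have hc₄' : W.c₄ ≠ 0 := by rwa [hW, baseChange, map_c₄, _root_.map_ne_zero]
  have h0 : ∀ v, v ≠ 0 → (φ.symm v).1 ≠ 0 := fun v hv h =>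
    hv (by simpa using (Subtype.ext h : φ.symm v = 0))
  refine ⟨fun v hv => isGammaRoot_torsRoot (h0 v hv) (φ.symm v).2, fun v w hv hw h => ?_,
    fun r hr => ?_, fun v => ?_, fun σ v => ?_⟩
  · exact φ.symm.injective <| Subtype.ext <|
      torsRoot_injOn hc₄' (h0 v hv) (h0 w hw) (φ.symm v).2 (φ.symm w).2 h
  · obtain ⟨P, hP0, h3, hP⟩ := exists_torsRoot hΔ' hc₄' hr
    refine ⟨φ ⟨P, h3⟩, fun h => hP0 ?_, by simpa using hP⟩
    have := φ.map_eq_zero_iff.mp h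
    exact congrArg Subtype.val this
  · rw [map_neg, ← torsRoot_neg]
    rfl
  · have := torsionRep_mulVec φ σ (φ.symm v)
    rw [φ.apply_symm_apply] at this
    rw [this, φ.symm_apply_apply, coe_torsionHom, torsRoot_map]
    rfl

/-- A trivial matrix fixes every root of `γ`, and the roots generate `L`. -/
theorem IsGammaParam.rep_injective [E.gammaPoly.IsSplittingField K L]
    {ρ : (L ≃ₐ[K] L) →* GL (Fin 2) (ZMod 3)} {s : (Fin 2 → ZMod 3) → L}
    (h : E.IsGammaParam ρ s) : Function.Injective ρ := by
  rw [injective_iff_map_eq_one]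
  intro σ hσ
  have hfix : ∀ r ∈ E.gammaPoly.rootSet L, σ r = r := fun r hr => by
    obtain ⟨v, -, rfl⟩ := h.surj r ((mem_rootSet_gammaPoly r).mp hr)
    rw [h.equivariant, hσ, Units.val_one, Matrix.one_mulVec]
  have htop := IsSplittingField.adjoin_rootSet L E.gammaPoly
  have : (σ : L →ₐ[K] L) = AlgHom.id K L :=
    AlgHom.ext_of_adjoin_eq_top htop fun r hr => hfix r hr
  ext x
  exact DFunLike.congr_fun this x

end Rep

end WeierstrassCurve

namespace WeierstrassCurve

/-! ### Resolvent cubic -/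

section Resolvent

variable {F : Type*} [Field F]

/-- Relations between the coefficients of a depressed quartic and four distinct roots of it. -/
theorem vieta_quartic {p q r t₁ t₂ t₃ t₄ : F}
    (h₁ : t₁ ^ 4 + p * t₁ ^ 2 + q * t₁ + r = 0) (h₂ : t₂ ^ 4 + p * t₂ ^ 2 + q * t₂ + r = 0)
    (h₃ : t₃ ^ 4 + p * t₃ ^ 2 + q * t₃ + r = 0) (h₄ : t₄ ^ 4 + p * t₄ ^ 2 + q * t₄ + r = 0)
    (h₁₂ : t₁ ≠ t₂) (h₁₃ : t₁ ≠ t₃) (h₁₄ : t₁ ≠ t₄) (h₂₃ : t₂ ≠ t₃) (h₂₄ : t₂ ≠ t₄)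
    (h₃₄ : t₃ ≠ t₄) :
    t₄ = -t₁ - t₂ - t₃ ∧ p = -(t₁ ^ 2 + t₂ ^ 2 + t₃ ^ 2 + t₁ * t₂ + t₁ * t₃ + t₂ * t₃) ∧
      q = (t₁ + t₂) * (t₁ + t₃) * (t₂ + t₃) ∧ r = -(t₁ * t₂ * t₃ * (t₁ + t₂ + t₃)) := by
  -- Successive divided differences at distinct roots: `a`, `b`, `c` are the first, second and
  -- third.
  have a : ∀ {x y : F}, x ≠ y → x ^ 4 + p * x ^ 2 + q * x + r = 0 →
      y ^ 4 + p * y ^ 2 + q * y + r = 0 →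
      x ^ 3 + x ^ 2 * y + x * y ^ 2 + y ^ 3 + p * (x + y) + q = 0 := by
    intro x y hxy hx hy
    apply (mul_eq_zero.mp _).resolve_left (sub_ne_zero.mpr hxy)
    linear_combination hx - hy
  have b : ∀ {y z : F}, t₁ ≠ y → t₁ ≠ z → y ≠ z → y ^ 4 + p * y ^ 2 + q * y + r = 0 →
      z ^ 4 + p * z ^ 2 + q * z + r = 0 →
      t₁ ^ 2 + y ^ 2 + z ^ 2 + t₁ * y + t₁ * z + y * z + p = 0 := by
    intro y z h1 h2 h3 hy hz
    apply (mul_eq_zero.mp _).resolve_left (sub_ne_zero.mpr h3)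
    linear_combination a h1 h₁ hy - a h2 h₁ hz
  have c : t₁ + t₂ + t₃ + t₄ = 0 := by
    apply (mul_eq_zero.mp _).resolve_left (sub_ne_zero.mpr h₃₄)
    linear_combination b h₁₂ h₁₃ h₂₃ h₂ h₃ - b h₁₂ h₁₄ h₂₄ h₂ h₄
  have hp := b h₁₂ h₁₃ h₂₃ h₂ h₃
  have hq := a h₁₂ h₁ h₂
  refine ⟨by linear_combination c, by linear_combination hp, ?_, ?_⟩
  · linear_combination hq - (t₁ + t₂) * hp
  · linear_combination h₁ - t₁ * hq + t₁ * t₂ * hp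

/-- The shifted roots of the resolvent cubic of `t⁴ - 6c₄t² - 8c₆t - 3c₄²` are the three cube roots
of one element. -/
theorem resolvent_roots [CharZero F] {c₄ c₆ t₁ t₂ t₃ t₄ : F}
    (h₁ : t₁ ^ 4 - 6 * c₄ * t₁ ^ 2 - 8 * c₆ * t₁ - 3 * c₄ ^ 2 = 0)
    (h₂ : t₂ ^ 4 - 6 * c₄ * t₂ ^ 2 - 8 * c₆ * t₂ - 3 * c₄ ^ 2 = 0)
    (h₃ : t₃ ^ 4 - 6 * c₄ * t₃ ^ 2 - 8 * c₆ * t₃ - 3 * c₄ ^ 2 = 0)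
    (h₄ : t₄ ^ 4 - 6 * c₄ * t₄ ^ 2 - 8 * c₆ * t₄ - 3 * c₄ ^ 2 = 0)
    (h₁₂ : t₁ ≠ t₂) (h₁₃ : t₁ ≠ t₃) (h₁₄ : t₁ ≠ t₄) (h₂₃ : t₂ ≠ t₃) (h₂₄ : t₂ ≠ t₄)
    (h₃₄ : t₃ ≠ t₄) {A B C : F} (hA : A = t₁ * t₂ + t₃ * t₄ + 2 * c₄)
    (hB : B = t₁ * t₃ + t₂ * t₄ + 2 * c₄) (hC : C = t₁ * t₄ + t₂ * t₃ + 2 * c₄) :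
    A ≠ B ∧ A + B + C = 0 ∧ A * B + B * C + A * C = 0 ∧ A ^ 3 = -64 * (c₄ ^ 3 - c₆ ^ 2) := by
  obtain ⟨e1, e2, e3, e4⟩ := vieta_quartic (p := -6 * c₄) (q := -8 * c₆) (r := -3 * c₄ ^ 2)
    (by linear_combination h₁) (by linear_combination h₂) (by linear_combination h₃)
    (by linear_combination h₄) h₁₂ h₁₃ h₁₄ h₂₃ h₂₄ h₃₄
  have hc₄ : c₄ = (t₁ ^ 2 + t₂ ^ 2 + t₃ ^ 2 + t₁ * t₂ + t₁ * t₃ + t₂ * t₃) / 6 := by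
    linear_combination (-1 / 6) * e2
  have hc₆ : c₆ = -((t₁ + t₂) * (t₁ + t₃) * (t₂ + t₃)) / 8 := by
    linear_combination (-1 / 8) * e3
  -- For this quartic the invariant `p² + 12r` vanishes, as `36c₄² - 36c₄² = 0`. This is what kills
  -- the linear term of the shifted resolvent.
  have hI : (t₁ ^ 2 + t₂ ^ 2 + t₃ ^ 2 + t₁ * t₂ + t₁ * t₃ + t₂ * t₃) ^ 2 =
      12 * (t₁ * t₂ * t₃ * (t₁ + t₂ + t₃)) := by
    rw [hc₄] at e4
    linear_combination (-12) * e4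
  have hs : A + B + C = 0 := by
    rw [hA, hB, hC, e1, hc₄]
    ring
  have hp : A * B + B * C + A * C = 0 := by
    rw [hA, hB, hC, e1, hc₄]
    linear_combination (-1 / 3) * hI
  refine ⟨?_, hs, hp, ?_⟩
  · rw [hA, hB, ← sub_ne_zero]
    have : (t₁ - t₄) * (t₂ - t₃) ≠ 0 := mul_ne_zero (sub_ne_zero.mpr h₁₄) (sub_ne_zero.mpr h₂₃)
    convert! this using 1
    ring
  · have h3 : A ^ 3 = A * B * C := by linear_combination A ^ 2 * hs - A * hp
    rw [h3, hA, hB, hC, e1, hc₄, hc₆]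
    linear_combination (2 / 9 * (t₁ ^ 2 + t₂ ^ 2 + t₃ ^ 2 + t₁ * t₂ + t₁ * t₃ + t₂ * t₃)) * hI

/-- The two hypotheses say that `(x - A)(x - B)(x - C) = x³ - ABC`. -/
theorem cube_roots_facts {A B C : F} (hs : A + B + C = 0) (hp : A * B + B * C + A * C = 0) :
    B ^ 2 = A * C ∧ C ^ 2 = A * B ∧ A ^ 2 = B * C ∧ B ^ 3 = A ^ 3 ∧ C ^ 3 = A ^ 3 ∧
      ∀ x, x ^ 3 = A ^ 3 → x = A ∨ x = B ∨ x = C := by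
  have hA : A ^ 2 = B * C := by linear_combination A * hs - hp
  have hB : B ^ 2 = A * C := by linear_combination B * hs - hp
  have hC : C ^ 2 = A * B := by linear_combination C * hs - hp
  refine ⟨hB, hC, hA, by linear_combination B * hB - A * hA, by linear_combination C * hC - A * hA,
    fun x hx => ?_⟩
  have : (x - A) * ((x - B) * (x - C)) = 0 := by
    linear_combination hx - x ^ 2 * hs + x * hp + A * hA
  simpa [sub_eq_zero] using this

end Resolvent

/-! ### The determinant, cube roots of unity and cube roots of the discriminant -/

section Arithmetic

variable {K : Type*} [Field K] {E : WeierstrassCurve K} {L : Type*} [Field L] [Algebra K L]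
  {ρ : (L ≃ₐ[K] L) →* GL (Fin 2) (ZMod 3)} {s : (Fin 2 → ZMod 3) → L}

/-- The index of the line in `𝔽₃²` through `(x, y)`. -/
def lineIndex (x y : ZMod 3) : Fin 4 :=
  if y = 0 then 0 else if x = 0 then 1 else if x = y then 2 else 3

/-- A representative of a line in `𝔽₃²`. -/
def lineRep : Fin 4 → Fin 2 → ZMod 3 := ![![1, 0], ![0, 1], ![1, 1], ![1, -1]]

theorem eq_or_eq_neg_lineRep (x y : ZMod 3) (h : x ≠ 0 ∨ y ≠ 0) :
    ![x, y] = lineRep (lineIndex x y) ∨ ![x, y] = -lineRep (lineIndex x y) := by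
  revert x y; decide

/-- `PGL(2, 𝔽₃)` is the symmetric group on the four lines, and determinant `1` corresponds to the
twelve even permutations, `-1` to the twelve odd ones. -/
theorem lineIndex_perm_of_det_one : ∀ a b c d : ZMod 3, a * d - b * c = 1 →
    (lineIndex a c, lineIndex b d, lineIndex (a + b) (c + d), lineIndex (a - b) (c - d)) ∈
      [((0 : Fin 4), (1 : Fin 4), (2 : Fin 4), (3 : Fin 4)), (1, 0, 3, 2), (2, 3, 0, 1),
        (3, 2, 1, 0), (0, 2, 3, 1), (2, 0, 1, 3), (3, 1, 0, 2), (1, 3, 2, 0), (0, 3, 1, 2),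
        (3, 0, 2, 1), (1, 2, 0, 3), (2, 1, 3, 0)] := by
  decide

theorem lineIndex_perm_of_det_neg_one : ∀ a b c d : ZMod 3, a * d - b * c = -1 →
    (lineIndex a c, lineIndex b d, lineIndex (a + b) (c + d), lineIndex (a - b) (c - d)) ∈
      [((1 : Fin 4), (0 : Fin 4), (2 : Fin 4), (3 : Fin 4)), (0, 1, 3, 2), (3, 2, 0, 1),
        (2, 3, 1, 0), (2, 0, 3, 1), (0, 2, 1, 3), (1, 3, 0, 2), (3, 1, 2, 0), (3, 0, 1, 2),
        (0, 3, 2, 1), (2, 1, 0, 3), (1, 2, 3, 0)] := by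
  decide

/-- The root of the quartic attached to a line in `𝔽₃²`. -/
noncomputable def lineRoot (s : (Fin 2 → ZMod 3) → L) (i : Fin 4) : L := s (lineRep i) ^ 2

/-- The shifted roots of the resolvent cubic attached to the pairings of the four lines. -/
noncomputable def pairingRoot (E : WeierstrassCurve K) (s : (Fin 2 → ZMod 3) → L) : Fin 3 → L :=
  ![lineRoot s 0 * lineRoot s 1 + lineRoot s 2 * lineRoot s 3 + 2 * algebraMap K L E.c₄,
    lineRoot s 0 * lineRoot s 2 + lineRoot s 1 * lineRoot s 3 + 2 * algebraMap K L E.c₄,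
    lineRoot s 0 * lineRoot s 3 + lineRoot s 1 * lineRoot s 2 + 2 * algebraMap K L E.c₄]

theorem lineRep_ne_zero : ∀ i, lineRep i ≠ 0 := by decide

theorem IsGammaParam.quartic (h : E.IsGammaParam ρ s) (i : Fin 4) :
    lineRoot s i ^ 4 - 6 * algebraMap K L E.c₄ * lineRoot s i ^ 2
      - 8 * algebraMap K L E.c₆ * lineRoot s i - 3 * algebraMap K L E.c₄ ^ 2 = 0 := by
  have := h.isGammaRoot _ (lineRep_ne_zero i)
  simp only [IsGammaRoot, baseChange, map_c₄, map_c₆] at this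
  rw [lineRoot]
  linear_combination this

theorem IsGammaParam.lineRoot_injective (h : E.IsGammaParam ρ s) :
    Function.Injective (lineRoot s) := by
  have hd : ∀ i j : Fin 4, lineRep i = lineRep j ∨ lineRep i = -lineRep j → i = j := by decide
  have hn : ∀ i : Fin 4, -lineRep i ≠ 0 := by decide
  intro i j hij
  refine hd i j ?_
  rcases sq_eq_sq_iff_eq_or_eq_neg.mp hij with h1 | h1
  · exact Or.inl (h.injOn _ _ (lineRep_ne_zero i) (lineRep_ne_zero j) h1)
  · rw [← h.neg] at h1
    exact Or.inr (h.injOn _ _ (lineRep_ne_zero i) (hn j) h1)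

theorem IsGammaParam.pairingRoot_facts [CharZero L] (h : E.IsGammaParam ρ s) :
    pairingRoot E s 0 ≠ pairingRoot E s 1 ∧
      pairingRoot E s 0 + pairingRoot E s 1 + pairingRoot E s 2 = 0 ∧
      pairingRoot E s 0 * pairingRoot E s 1 + pairingRoot E s 1 * pairingRoot E s 2
        + pairingRoot E s 0 * pairingRoot E s 2 = 0 ∧
      pairingRoot E s 0 ^ 3 = (-48) ^ 3 * algebraMap K L E.Δ := by
  have hne : ∀ {i j : Fin 4}, i ≠ j → lineRoot s i ≠ lineRoot s j := fun hij =>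
    h.lineRoot_injective.ne hij
  obtain ⟨h1, h2, h3, h4⟩ := resolvent_roots (h.quartic 0) (h.quartic 1) (h.quartic 2)
    (h.quartic 3) (hne (by decide)) (hne (by decide)) (hne (by decide)) (hne (by decide))
    (hne (by decide)) (hne (by decide)) (A := pairingRoot E s 0) (B := pairingRoot E s 1)
    (C := pairingRoot E s 2) rfl rfl rfl
  refine ⟨h1, h2, h3, h4.trans ?_⟩
  have := congrArg (algebraMap K L) E.c_relation
  simp only [map_mul, map_sub, map_pow, map_ofNat] at this
  -- `c₄³ - c₆² = 1728Δ` and `64 · 1728 = 48³`.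
  linear_combination 64 * this

theorem IsGammaParam.sq_apply (h : E.IsGammaParam ρ s) {x y : ZMod 3} (hxy : ![x, y] ≠ 0) :
    s ![x, y] ^ 2 = lineRoot s (lineIndex x y) := by
  have h0 : x ≠ 0 ∨ y ≠ 0 := by
    by_contra! h0
    exact hxy (by rw [h0.1, h0.2]; decide)
  rw [lineRoot]
  rcases eq_or_eq_neg_lineRep x y h0 with h1 | h1
  · rw [h1]
  · rw [h1, h.neg, neg_sq]

theorem IsGammaParam.apply_lineRoot (h : E.IsGammaParam ρ s) (σ : L ≃ₐ[K] L)
    {a b c d : ZMod 3} (hσ : (ρ σ).1 = !![a, b; c, d]) :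
    σ (lineRoot s 0) = lineRoot s (lineIndex a c) ∧
    σ (lineRoot s 1) = lineRoot s (lineIndex b d) ∧
    σ (lineRoot s 2) = lineRoot s (lineIndex (a + b) (c + d)) ∧
    σ (lineRoot s 3) = lineRoot s (lineIndex (a - b) (c - d)) := by
  have key : ∀ i x y, (ρ σ).1.mulVec (lineRep i) = ![x, y] →
      σ (lineRoot s i) = lineRoot s (lineIndex x y) := by
    intro i x y hi
    rw [lineRoot, map_pow, h.equivariant, hi, h.sq_apply]
    intro h0
    rw [h0] at hi
    have := congrArg (ρ σ)⁻¹.1.mulVec hi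
    rw [Matrix.mulVec_mulVec, ← Units.val_mul, inv_mul_cancel, Units.val_one, Matrix.one_mulVec,
      Matrix.mulVec_zero] at this
    exact lineRep_ne_zero i this
  refine ⟨key 0 _ _ ?_, key 1 _ _ ?_, key 2 _ _ ?_, key 3 _ _ ?_⟩ <;>
    rw [hσ] <;> ext i <;> fin_cases i <;>
    simp [lineRep, Matrix.mulVec, dotProduct, Fin.sum_univ_two, sub_eq_add_neg]

theorem apply_pairingRoot_zero {σ : L ≃ₐ[K] L} {i j k l : Fin 4}
    (h0 : σ (lineRoot s 0) = lineRoot s i) (h1 : σ (lineRoot s 1) = lineRoot s j)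
    (h2 : σ (lineRoot s 2) = lineRoot s k) (h3 : σ (lineRoot s 3) = lineRoot s l) :
    σ (pairingRoot E s 0) = lineRoot s i * lineRoot s j + lineRoot s k * lineRoot s l + 2 * algebraMap K L E.c₄ := by
  simp [pairingRoot, h0, h1, h2, h3, map_ofNat σ 2]

theorem apply_pairingRoot_one {σ : L ≃ₐ[K] L} {i j k l : Fin 4}
    (h0 : σ (lineRoot s 0) = lineRoot s i) (h1 : σ (lineRoot s 1) = lineRoot s j)
    (h2 : σ (lineRoot s 2) = lineRoot s k) (h3 : σ (lineRoot s 3) = lineRoot s l) :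
    σ (pairingRoot E s 1) = lineRoot s i * lineRoot s k + lineRoot s j * lineRoot s l + 2 * algebraMap K L E.c₄ := by
  simp [pairingRoot, h0, h1, h2, h3, map_ofNat σ 2]

theorem apply_pairingRoot_two {σ : L ≃ₐ[K] L} {i j k l : Fin 4}
    (h0 : σ (lineRoot s 0) = lineRoot s i) (h1 : σ (lineRoot s 1) = lineRoot s j)
    (h2 : σ (lineRoot s 2) = lineRoot s k) (h3 : σ (lineRoot s 3) = lineRoot s l) :
    σ (pairingRoot E s 2) = lineRoot s i * lineRoot s l + lineRoot s j * lineRoot s k + 2 * algebraMap K L E.c₄ := by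
  simp [pairingRoot, h0, h1, h2, h3, map_ofNat σ 2]

/-- On the three pairings of four objects `S₄` acts through `S₃`, and the even permutations act
through rotations. -/
theorem IsGammaParam.apply_pairingRoot_of_det_one (h : E.IsGammaParam ρ s) (σ : L ≃ₐ[K] L)
    (hσ : (ρ σ).1.det = 1) :
    ∃ k : Fin 3, ∀ i, σ (pairingRoot E s i) = pairingRoot E s (i + k) := by
  obtain ⟨h0, h1, h2, h3⟩ := h.apply_lineRoot σ (Matrix.eta_fin_two _)
  rw [Matrix.det_fin_two] at hσ
  have hm := lineIndex_perm_of_det_one _ _ _ _ hσ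
  simp only [List.mem_cons, Prod.mk.injEq, List.not_mem_nil, or_false] at hm
  rcases hm with ⟨p, q, r, t⟩ | ⟨p, q, r, t⟩ | ⟨p, q, r, t⟩ | ⟨p, q, r, t⟩ | ⟨p, q, r, t⟩ |
    ⟨p, q, r, t⟩ | ⟨p, q, r, t⟩ | ⟨p, q, r, t⟩ | ⟨p, q, r, t⟩ | ⟨p, q, r, t⟩ | ⟨p, q, r, t⟩ |
    ⟨p, q, r, t⟩
  all_goals
    rw [p] at h0
    rw [q] at h1
    rw [r] at h2
    rw [t] at h3
    simp only [Fin.forall_fin_succ, IsEmpty.forall_iff, and_true,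
      apply_pairingRoot_zero h0 h1 h2 h3, apply_pairingRoot_one h0 h1 h2 h3, Fin.succ_zero_eq_one,
      apply_pairingRoot_two h0 h1 h2 h3, Fin.succ_one_eq_two]
    first
    | (refine ⟨0, ?_, ?_, ?_⟩ <;> simp [pairingRoot] <;> ring1)
    | (refine ⟨1, ?_, ?_, ?_⟩ <;> simp [pairingRoot] <;> ring1)
    | (refine ⟨2, ?_, ?_, ?_⟩ <;> simp [pairingRoot] <;> ring1)

/-- Odd permutations of the lines act on the pairings through the transpositions of `S₃`, which are
the maps `i ↦ k - i`. -/
theorem IsGammaParam.apply_pairingRoot_of_det_neg_one (h : E.IsGammaParam ρ s) (σ : L ≃ₐ[K] L)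
    (hσ : (ρ σ).1.det = -1) :
    ∃ k : Fin 3, ∀ i, σ (pairingRoot E s i) = pairingRoot E s (k - i) := by
  obtain ⟨h0, h1, h2, h3⟩ := h.apply_lineRoot σ (Matrix.eta_fin_two _)
  rw [Matrix.det_fin_two] at hσ
  have hm := lineIndex_perm_of_det_neg_one _ _ _ _ hσ
  simp only [List.mem_cons, Prod.mk.injEq, List.not_mem_nil, or_false] at hm
  rcases hm with ⟨p, q, r, t⟩ | ⟨p, q, r, t⟩ | ⟨p, q, r, t⟩ | ⟨p, q, r, t⟩ | ⟨p, q, r, t⟩ |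
    ⟨p, q, r, t⟩ | ⟨p, q, r, t⟩ | ⟨p, q, r, t⟩ | ⟨p, q, r, t⟩ | ⟨p, q, r, t⟩ | ⟨p, q, r, t⟩ |
    ⟨p, q, r, t⟩
  all_goals
    rw [p] at h0
    rw [q] at h1
    rw [r] at h2
    rw [t] at h3
    simp only [Fin.forall_fin_succ, IsEmpty.forall_iff, and_true,
      apply_pairingRoot_zero h0 h1 h2 h3, apply_pairingRoot_one h0 h1 h2 h3, Fin.succ_zero_eq_one,
      apply_pairingRoot_two h0 h1 h2 h3, Fin.succ_one_eq_two]
    first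
    | (refine ⟨0, ?_, ?_, ?_⟩ <;> simp [pairingRoot] <;> ring1)
    | (refine ⟨1, ?_, ?_, ?_⟩ <;> simp [pairingRoot] <;> ring1)
    | (refine ⟨2, ?_, ?_, ?_⟩ <;> simp [pairingRoot] <;> ring1)

end Arithmetic

end WeierstrassCurve

namespace WeierstrassCurve

/-! ### Roots of unity, cubes and rational points read off from the image of Galois. -/

section GaloisArithmetic

variable {K : Type*} [Field K] [CharZero K] {E : WeierstrassCurve K} {L : Type*} [Field L]
  [Algebra K L] {ρ : (L ≃ₐ[K] L) →* GL (Fin 2) (ZMod 3)} {s : (Fin 2 → ZMod 3) → L}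

omit [CharZero K] in
theorem IsGammaParam.pairingRoot_ne_zero [CharZero L] (h : E.IsGammaParam ρ s) (hΔ : E.Δ ≠ 0) :
    pairingRoot E s 0 ≠ 0 := by
  obtain ⟨-, -, -, h3⟩ := h.pairingRoot_facts
  intro h0
  rw [h0, zero_pow three_ne_zero, eq_comm, mul_eq_zero, _root_.map_eq_zero] at h3
  exact h3.elim (by norm_num) hΔ

omit [CharZero K] in
theorem IsGammaParam.isPrimitiveRoot_div [CharZero L] (h : E.IsGammaParam ρ s) (hΔ : E.Δ ≠ 0) :
    IsPrimitiveRoot (pairingRoot E s 1 / pairingRoot E s 0) 3 := by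
  obtain ⟨hne, hs, hp, h3⟩ := h.pairingRoot_facts
  obtain ⟨-, -, -, hB, -, -⟩ := cube_roots_facts hs hp
  have h0 := h.pairingRoot_ne_zero hΔ
  rw [IsPrimitiveRoot.iff_orderOf]
  apply orderOf_eq_prime
  · rw [div_pow, hB, div_self (pow_ne_zero 3 h0)]
  · rw [ne_eq, div_eq_one_iff_eq h0]
    exact hne.symm

-- The three cube roots form a cyclic geometric progression, so a rotation preserves the ratio of
-- neighbours. A reflection inverts it; together these play the role of the Weil pairing.
omit [CharZero K] in
theorem IsGammaParam.apply_div_of_det_one [CharZero L] (h : E.IsGammaParam ρ s) (hΔ : E.Δ ≠ 0)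
    {σ : L ≃ₐ[K] L} (hσ : (ρ σ).1.det = 1) :
    σ (pairingRoot E s 1 / pairingRoot E s 0) = pairingRoot E s 1 / pairingRoot E s 0 := by
  obtain ⟨hne, hs, hp, h3⟩ := h.pairingRoot_facts
  obtain ⟨hB, hC, hA, -, -, -⟩ := cube_roots_facts hs hp
  have h0 := h.pairingRoot_ne_zero hΔ
  obtain ⟨k, hk⟩ := h.apply_pairingRoot_of_det_one σ hσ
  have h0' : σ (pairingRoot E s 0) ≠ 0 := (_root_.map_ne_zero σ).mpr h0
  rw [map_div₀, div_eq_div_iff h0' h0, hk, hk]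
  fin_cases k
  · simp
  · simp only [Fin.mk_one, show (1 : Fin 3) + 1 = 2 from rfl, zero_add]
    linear_combination -hB
  · simp only [Fin.reduceFinMk, show (1 : Fin 3) + 2 = 0 from rfl, zero_add]
    linear_combination hA

omit [CharZero K] in
theorem IsGammaParam.apply_div_of_det_neg_one [CharZero L] (h : E.IsGammaParam ρ s)
    (hΔ : E.Δ ≠ 0) {σ : L ≃ₐ[K] L} (hσ : (ρ σ).1.det = -1) :
    σ (pairingRoot E s 1 / pairingRoot E s 0) ≠ pairingRoot E s 1 / pairingRoot E s 0 := by
  obtain ⟨hne, hs, hp, h3⟩ := h.pairingRoot_facts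
  obtain ⟨hB, hC, hA, hB3, -, -⟩ := cube_roots_facts hs hp
  have h0 := h.pairingRoot_ne_zero hΔ
  obtain ⟨k, hk⟩ := h.apply_pairingRoot_of_det_neg_one σ hσ
  have h0' : σ (pairingRoot E s 0) ≠ 0 := (_root_.map_ne_zero σ).mpr h0
  -- The cubes agree, so equal squares would make the two roots equal.
  have hsq : pairingRoot E s 0 ^ 2 ≠ pairingRoot E s 1 ^ 2 := by
    intro hsq
    apply hne
    apply mul_left_cancel₀ (pow_ne_zero 2 h0)
    linear_combination -hB3 + pairingRoot E s 1 * (-hsq)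
  rw [map_div₀, ne_eq, div_eq_div_iff h0' h0, hk, hk]
  intro h
  apply hsq
  fin_cases k
  · simp only [Fin.zero_eta, show (0 : Fin 3) - 1 = 2 from rfl, sub_zero] at h
    rw [hA, mul_right_cancel₀ h0 h, sq]
  · simp only [Fin.mk_one, sub_self, sub_zero] at h
    linear_combination h
  · simp only [Fin.reduceFinMk, show (2 : Fin 3) - 1 = 1 from rfl, sub_zero] at h
    exact absurd (mul_left_cancel₀ h0 (by linear_combination hA - h)) hne

theorem det_eq_one_or_neg_one (g : GL (Fin 2) (ZMod 3)) : g.1.det = 1 ∨ g.1.det = -1 := by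
  have h1 : g.1.det ≠ 0 := ((Matrix.isUnit_iff_isUnit_det _).mp g.isUnit).ne_zero
  have : ∀ x : ZMod 3, x ≠ 0 → x = 1 ∨ x = -1 := by decide
  exact this _ h1

/-- `K` contains the third roots of unity iff Galois acts with determinant one. -/
theorem IsGammaParam.exists_isPrimitiveRoot_iff [FiniteDimensional K L] [IsGalois K L]
    (h : E.IsGammaParam ρ s) (hΔ : E.Δ ≠ 0) :
    (∃ ζ : K, IsPrimitiveRoot ζ 3) ↔ ∀ σ, (ρ σ).1.det = 1 := by
  have : CharZero L := charZero_of_injective_algebraMap (algebraMap K L).injective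
  have hω := h.isPrimitiveRoot_div hΔ
  constructor
  · rintro ⟨ζ, hζ⟩ σ
    refine (det_eq_one_or_neg_one (ρ σ)).resolve_right fun hσ => ?_
    apply h.apply_div_of_det_neg_one hΔ hσ
    have hζ' := hζ.map_of_injective (algebraMap K L).injective
    obtain ⟨i, -, hi⟩ := hζ'.eq_pow_of_pow_eq_one hω.pow_eq_one
    rw [← hi, map_pow, AlgEquiv.commutes]
  · intro hdet
    obtain ⟨ζ, hζ⟩ := (IsGalois.mem_range_algebraMap_iff_fixed _).mpr fun σ =>
      h.apply_div_of_det_one hΔ (hdet σ)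
    rw [← hζ] at hω
    exact ⟨ζ, hω.of_map_of_injective (algebraMap K L).injective⟩

/-- `X³ - Δ` is then irreducible over `K`, and a pairing root divided by `-48` is a root of it in
`L`. -/
theorem IsGammaParam.three_dvd_card [FiniteDimensional K L] [IsGalois K L]
    (h : E.IsGammaParam ρ s) (hcube : ¬ ∃ d : K, d ^ 3 = E.Δ) : 3 ∣ Nat.card (L ≃ₐ[K] L) := by
  have : CharZero L := charZero_of_injective_algebraMap (algebraMap K L).injective
  obtain ⟨-, -, -, h3⟩ := h.pairingRoot_facts
  have hirr := X_pow_sub_C_irreducible_of_prime Nat.prime_three (a := E.Δ)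
    fun b hb => hcube ⟨b, hb⟩
  have hroot : aeval (pairingRoot E s 0 / (-48)) (X ^ 3 - C E.Δ) = 0 := by
    simp only [map_sub, map_pow, aeval_X, aeval_C, div_pow, h3]
    field_simp
    ring
  have hmin := minpoly.eq_of_irreducible_of_monic hirr hroot (monic_X_pow_sub_C _ three_ne_zero)
  rw [IsGalois.card_aut_eq_finrank]
  have := minpoly.degree_dvd (K := K) (L := L) (x := pairingRoot E s 0 / (-48))
    (Algebra.IsIntegral.isIntegral _)
  rwa [← hmin, natDegree_X_pow_sub_C] at this

/-- This matrix permutes the three pairing roots cyclically, yet one of them is `-48d`, which lies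
in `K` and is fixed. -/
theorem IsGammaParam.rep_ne_unipotent (h : E.IsGammaParam ρ s) [CharZero L]
    (hcube : ∃ d : K, d ^ 3 = E.Δ) (σ : L ≃ₐ[K] L) : (ρ σ).1 ≠ !![1, 1; 0, 1] := by
  intro hσ
  obtain ⟨d, hd⟩ := hcube
  obtain ⟨hne, hs, hp, h3⟩ := h.pairingRoot_facts
  obtain ⟨hB, hC, hA, hB3, hC3, hx⟩ := cube_roots_facts hs hp
  obtain ⟨h0, h1, h2, h4⟩ := h.apply_lineRoot σ hσ
  have hσ0 : σ (pairingRoot E s 0) = pairingRoot E s 1 := by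
    rw [apply_pairingRoot_zero h0 h1 h2 h4]
    have e1 : lineIndex 1 0 = 0 := by decide
    have e2 : lineIndex 1 1 = 2 := by decide
    have e3 : lineIndex (1 + 1) (0 + 1) = 3 := by decide
    have e4 : lineIndex (1 - 1) (0 - 1) = 1 := by decide
    rw [e1, e2, e3, e4]
    simp [pairingRoot]
    ring
  have hσ1 : σ (pairingRoot E s 1) = pairingRoot E s 2 := by
    rw [apply_pairingRoot_one h0 h1 h2 h4]
    have e1 : lineIndex 1 0 = 0 := by decide
    have e2 : lineIndex 1 1 = 2 := by decide
    have e3 : lineIndex (1 + 1) (0 + 1) = 3 := by decide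
    have e4 : lineIndex (1 - 1) (0 - 1) = 1 := by decide
    rw [e1, e2, e3, e4]
    simp [pairingRoot]
    ring
  have hfix : σ (algebraMap K L (-48 * d)) = algebraMap K L (-48 * d) := σ.commutes _
  have hd3 : (algebraMap K L (-48 * d)) ^ 3 = pairingRoot E s 0 ^ 3 := by
    rw [h3, ← map_pow, mul_pow, hd, map_mul, map_pow, map_neg, map_ofNat]
  rcases hx _ hd3 with h5 | h5 | h5
  · rw [h5, hσ0] at hfix
    exact hne hfix.symm
  · rw [h5, hσ1] at hfix
    rw [hfix] at hs hp
    apply hne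
    have : pairingRoot E s 0 = -2 * pairingRoot E s 1 := by linear_combination hs
    rw [this] at hp ⊢
    have h6 : pairingRoot E s 1 = 0 := by
      have : 3 * pairingRoot E s 1 ^ 2 = 0 := by linear_combination -hp
      simpa using this
    rw [h6]; simp
  · have hs' := congrArg σ hs
    rw [map_add, map_add, hσ0, hσ1, ← h5, hfix, map_zero, h5] at hs'
    have : pairingRoot E s 0 = pairingRoot E s 2 := by linear_combination hs - hs'
    apply hne
    rw [← hσ0, this, ← h5, hfix, h5]

omit [CharZero K] in
theorem IsGammaParam.exists_root_of_fixed [FiniteDimensional K L] [IsGalois K L]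
    (h : E.IsGammaParam ρ s) {v : Fin 2 → ZMod 3} (hv : v ≠ 0)
    (hfix : ∀ σ, (ρ σ).1.mulVec v = v) : ∃ r : K, E.IsGammaRoot r := by
  obtain ⟨r, hr⟩ := (IsGalois.mem_range_algebraMap_iff_fixed (F := K) (s v)).mpr fun σ => by
    rw [h.equivariant, hfix]
  refine ⟨r, ?_⟩
  have := h.isGammaRoot v hv
  rw [← hr] at this
  apply (algebraMap K L).injective
  simp only [IsGammaRoot, baseChange, map_c₄, map_c₆] at this
  simpa only [IsGammaRoot, map_sub, map_mul, map_pow, map_ofNat, map_zero] using this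

end GaloisArithmetic

end WeierstrassCurve

namespace WeierstrassCurve

/-! ### Reduction of curves with a rational three-torsion point -/

section Reduction

open IsDiscreteValuationRing IsDedekindDomain.HeightOneSpectrum

variable {R : Type*} [CommRing R] [IsDomain R] [IsDiscreteValuationRing R]
  {K : Type*} [Field K] [Algebra R K] [IsFractionRing R K]

theorem valuation_eq_one_of_isUnit {u : R} (hu : IsUnit u) :
    valuation K (maximalIdeal R) (algebraMap R K u) = 1 := by
  refine le_antisymm (valuation_le_one _ _) (not_lt.mp fun h => ?_)
  exact (IsLocalRing.mem_maximalIdeal u).mp ((valuation_lt_one_iff_mem _ _).mp h) hu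

theorem isUnit_of_valuation_eq_one {u : R}
    (hu : valuation K (maximalIdeal R) (algebraMap R K u) = 1) : IsUnit u := by
  by_contra h
  exact ((valuation_lt_one_iff_mem (K := K) (maximalIdeal R) u).mpr
    ((IsLocalRing.mem_maximalIdeal u).mpr h)).ne hu

/-- A minimal model has the largest discriminant valuation in the multiplicative sense; if some
integral model attains `1`, so does every minimal one, whereas additive reduction requires less than
`1`. -/
theorem not_hasAdditiveReduction_of_isUnit {W : WeierstrassCurve K} {C D : VariableChange K}
    (hC : IsIntegral R (C • W)) {u : R} (hu : IsUnit u) (hΔ : algebraMap R K u = (C • W).Δ) :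
    ¬ (D • W).HasAdditiveReduction R := by
  intro h
  have hmin := h.toIsMinimal.val_Δ_maximal
  have hCD : (C * D⁻¹) • (D • W) = C • W := by rw [← mul_smul, inv_mul_cancel_right]
  have h1 : (valuation_Δ_aux R ((1 : VariableChange K) • (D • W))).1 < 1 := by
    rw [one_smul, valuation_Δ_aux_eq_of_isIntegral]
    exact h.badReduction
  have h2 : (valuation_Δ_aux R ((C * D⁻¹) • (D • W))).1 = 1 := by
    rw [hCD, valuation_Δ_aux_eq_of_isIntegral, ← hΔ]
    exact valuation_eq_one_of_isUnit hu
  have h3 : (valuation_Δ_aux R ((C * D⁻¹) • (D • W))).1 ≤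
      (valuation_Δ_aux R ((1 : VariableChange K) • (D • W))).1 :=
    hmin.2 (j := C * D⁻¹) (by simpa only [hCD] using hC) (by
      change (valuation_Δ_aux R ((1 : VariableChange K) • (D • W))).1 ≤
        (valuation_Δ_aux R ((C * D⁻¹) • (D • W))).1
      rw [h2]
      exact h1.le)
  rw [h2] at h3
  exact absurd (h3.trans_lt h1) (lt_irrefl _)

theorem HasGoodReduction.exists_c₄_cube_div_Δ {W : WeierstrassCurve K} {C : VariableChange K}
    (h : (C • W).HasGoodReduction R) : ∃ j : R, algebraMap R K j = W.c₄ ^ 3 / W.Δ := by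
  have hint : IsIntegral R (C • W) := inferInstance
  have hΔ := h.goodReduction
  rw [← integralModel_Δ_eq R] at hΔ
  obtain ⟨u, hu⟩ := isUnit_of_valuation_eq_one hΔ
  -- The `j`-invariant computed on the good model; `c₄³` and `Δ` both have weight twelve, so the
  -- scaling cancels.
  refine ⟨(integralModel R (C • W)).c₄ ^ 3 * (u⁻¹ : Rˣ), ?_⟩
  have h1 := integralModel_Δ_eq R (C • W)
  have h2 := integralModel_c₄_eq R (C • W)
  rw [← hu, variableChange_Δ] at h1
  rw [variableChange_c₄] at h2
  have hu' : algebraMap R K u * algebraMap R K (u⁻¹ : Rˣ) = 1 := by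
    rw [← map_mul, Units.mul_inv, map_one]
  have hC : (C.u⁻¹ : Kˣ).val ≠ 0 := Units.ne_zero _
  have hΔ0 : W.Δ ≠ 0 := by
    intro h0
    rw [h0, mul_zero] at h1
    rw [h1, zero_mul] at hu'
    exact zero_ne_one hu'
  rw [map_mul, map_pow, h2, eq_div_iff hΔ0]
  apply mul_left_cancel₀ (pow_ne_zero 12 hC)
  linear_combination ((C.u⁻¹ : Kˣ).val ^ 12 * W.c₄ ^ 3) * hu'
    - ((C.u⁻¹ : Kˣ).val ^ 12 * W.c₄ ^ 3 * algebraMap R K (u⁻¹ : Rˣ)) * h1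

end Reduction

/-! ### Normal form at a rational point of order three. -/

section RationalPoint

variable {K : Type*} [Field K] [CharZero K] {E : WeierstrassCurve K}

/-- The change of variables which moves the point of order three attached to `r` to the origin,
makes its tangent horizontal, and scales by `u`. -/
noncomputable def torsionChange (E : WeierstrassCurve K) (r : K) (u : Kˣ) : VariableChange K :=
  ⟨u, E.pointX r, (r - E.a₁) / 2, E.pointY r⟩

/-- A flex at the origin with horizontal tangent leaves the form `y² + rxy + by = x³`, here rescaled
by `u`. -/
theorem torsionChange_smul (hc₄ : E.c₄ ≠ 0) {r : K} (hr : E.IsGammaRoot r) (u : Kˣ) :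
    E.torsionChange r u • E =
      ⟨(u⁻¹ : Kˣ) * r, 0, (u⁻¹ : Kˣ).val ^ 3 * ((r ^ 4 - E.c₄) / (24 * r)), 0, 0⟩ := by
  have h0 := hr.ne_zero hc₄
  have heq := equation_of_isGammaRoot hc₄ hr
  rw [Affine.equation_iff] at heq
  have hη : 2 * E.pointY r + E.a₁ * E.pointX r + E.a₃ = (r ^ 4 - E.c₄) / (24 * r) := by
    rw [pointY]; ring
  have hx : E.pointX r = (r ^ 2 - E.b₂) / 12 := rfl
  rw [variableChange_def]
  ext
  · simp only [torsionChange]; ring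
  · simp only [torsionChange, hx, b₂]; ring
  · simp only [torsionChange]; rw [← hη]; ring
  · simp only [torsionChange]
    have h1 : r * (2 * E.pointY r + E.a₁ * E.pointX r + E.a₃) = (r ^ 4 - E.c₄) / 24 := by
      rw [hη]; field_simp
    rw [mul_eq_zero]
    right
    rw [hx] at h1 ⊢
    simp only [c₄, b₂, b₄] at h1 ⊢
    linear_combination (-1 / 2) * h1
  · simp only [torsionChange]
    rw [mul_eq_zero]
    right
    linear_combination -heq

theorem Δ_eq_of_isGammaRoot (hc₄ : E.c₄ ≠ 0) {r b : K} (hr : E.IsGammaRoot r)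
    (hb : b = (r ^ 4 - E.c₄) / (24 * r)) : E.Δ = b ^ 3 * (r ^ 3 - 27 * b) := by
  have h0 := hr.ne_zero hc₄
  have h1 : E.c₄ = r * (r ^ 3 - 24 * b) := by rw [hb]; field_simp; ring
  have h2 : E.c₆ = -r ^ 6 + 36 * r ^ 3 * b - 216 * b ^ 2 := by
    unfold IsGammaRoot at hr
    rw [h1] at hr
    have : 8 * r ^ 2 * (E.c₆ - (-r ^ 6 + 36 * r ^ 3 * b - 216 * b ^ 2)) = 0 := by
      linear_combination -hr
    have h3 := (mul_eq_zero.mp this).resolve_left (mul_ne_zero (by norm_num) (pow_ne_zero 2 h0))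
    linear_combination h3
  have h3 := E.c_relation
  rw [h1, h2] at h3
  apply mul_left_cancel₀ (show (1728 : K) ≠ 0 by norm_num)
  linear_combination h3

/-- A curve with a rational point of order three, cube discriminant and integral `j`-invariant has
good reduction, if the residue characteristic is not three. -/
theorem exists_isIntegral_isUnit_of_isGammaRoot {R : Type*} [CommRing R] [IsDomain R]
    [ValuationRing R] [Algebra R K] [IsFractionRing R K] (h3 : IsUnit (3 : R))
    (hΔ : E.Δ ≠ 0) (hc₄ : E.c₄ ≠ 0) {r : K} (hr : E.IsGammaRoot r) {d : K} (hd : d ^ 3 = E.Δ)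
    {j : R} (hj : algebraMap R K j = E.c₄ ^ 3 / E.Δ) :
    ∃ C : VariableChange K, IsIntegral R (C • E) ∧
      ∃ u : R, IsUnit u ∧ algebraMap R K u = (C • E).Δ := by
  have h0 := hr.ne_zero hc₄
  obtain ⟨b, hb⟩ : ∃ b, b = (r ^ 4 - E.c₄) / (24 * r) := ⟨_, rfl⟩
  have hb0 : b ≠ 0 := by
    rw [hb]
    exact div_ne_zero (hr.pow_four_ne hΔ hc₄) (mul_ne_zero (by norm_num) h0)
  have hΔb := Δ_eq_of_isGammaRoot hc₄ hr hb
  have hc₄b : E.c₄ = r * (r ^ 3 - 24 * b) := by rw [hb]; field_simp; ring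
  have hd0 : d ≠ 0 := by rintro rfl; exact hΔ (by rw [← hd]; simp)
  -- As `Δ = b³(r³ - 27b)` is the cube of `d`, this `B` is a cube root of `r³ - 27b`. Scaling by it
  -- leaves the one parameter `x = r / B` and discriminant `((x³ - 1) / 27)³`.
  obtain ⟨B, hB⟩ : ∃ B, B = d / b := ⟨_, rfl⟩
  have hB0 : B ≠ 0 := by rw [hB]; exact div_ne_zero hd0 hb0
  have hB3 : B ^ 3 = r ^ 3 - 27 * b := by
    rw [hB, div_pow, hd, hΔb]; field_simp
  have hinj := IsFractionRing.injective R K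
  obtain ⟨x, hx⟩ : ∃ x, x = r / B := ⟨_, rfl⟩
  have hx0 : x ≠ 0 := by rw [hx]; exact div_ne_zero h0 hB0
  have hrx : r = x * B := by rw [hx]; field_simp
  have hbx : b = B ^ 3 * (x ^ 3 - 1) / 27 := by
    rw [hrx] at hB3
    linear_combination (1 / 27) * hB3
  have hΔx : E.Δ = B ^ 12 * ((x ^ 3 - 1) / 27) ^ 3 := by
    rw [hΔb, ← hB3, hbx]; ring
  -- The `j`-invariant as a function of `x`; integrality of `j` and invertibility of `3` make `x`
  -- integral and `x³ - 1` a unit.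
  have key : 27 * x ^ 3 * (x ^ 3 + 8) ^ 3 = algebraMap R K j * (x ^ 3 - 1) ^ 3 := by
    rw [hj, div_mul_eq_mul_div, eq_div_iff hΔ, hΔx, hc₄b, hrx, hbx]
    ring
  have hxR : ∃ a : R, algebraMap R K a = x := by
    rcases ValuationRing.isInteger_or_isInteger R x with ⟨a, ha⟩ | ⟨z, hz⟩
    · exact ⟨a, ha⟩
    · have hzx : algebraMap R K z * x = 1 := by rw [hz]; field_simp
      -- In terms of `z = 1 / x` the relation reads `27(1 + 8z³)³ = jz³(1 - z³)³`, so `z` divides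
      -- the unit `27`.
      have h27 : (27 : R) = z * (j * z ^ 2 * (1 - z ^ 3) ^ 3
          - 27 * z ^ 2 * 8 * (3 + 3 * (8 * z ^ 3) + (8 * z ^ 3) ^ 2)) := by
        apply hinj
        simp only [map_mul, map_sub, map_add, map_pow, map_ofNat, map_one]
        rw [show x = (algebraMap R K z)⁻¹ by rw [hz, inv_inv]] at key
        have hz0 : algebraMap R K z ≠ 0 := by rw [hz]; exact inv_ne_zero hx0
        generalize algebraMap R K z = Z at *
        field_simp at key
        linear_combination key
      have hzu : IsUnit z := isUnit_of_mul_isUnit_left (y := _) (by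
        rw [← h27, show (27 : R) = 3 ^ 3 by norm_num]; exact h3.pow 3)
      obtain ⟨v, rfl⟩ := hzu
      refine ⟨(v⁻¹ : Rˣ), ?_⟩
      have : algebraMap R K v * algebraMap R K (v⁻¹ : Rˣ) = 1 := by
        rw [← map_mul, Units.mul_inv, map_one]
      rw [hz] at this
      field_simp at this
      exact this
  obtain ⟨a, ha⟩ := hxR
  have hw : IsUnit (a ^ 3 - 1) := by
    -- With `w = a³ - 1` the left side of `key` is `27(w + 1)(w + 9)³`, which is `3⁹` modulo `w`.
    have h9 : (3 : R) ^ 9 = (a ^ 3 - 1) * (j * (a ^ 3 - 1) ^ 2 -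
        27 * ((a ^ 3 - 1) ^ 3 + 28 * (a ^ 3 - 1) ^ 2 + 270 * (a ^ 3 - 1) + 972)) := by
      apply hinj
      simp only [map_mul, map_sub, map_add, map_pow, map_ofNat, map_one, ha]
      linear_combination key
    exact isUnit_of_mul_isUnit_left (by rw [← h9]; exact h3.pow 9)
  obtain ⟨i, hi⟩ := h3.pow 3
  have hi27 : algebraMap R K (i⁻¹ : Rˣ) = 1 / 27 := by
    rw [eq_div_iff (by norm_num), show (27 : K) = algebraMap R K i by rw [hi, map_pow, map_ofNat]; norm_num,
      ← map_mul, Units.inv_mul, map_one]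
  refine ⟨E.torsionChange r (Units.mk0 B hB0), ?_, ((a ^ 3 - 1) * (i⁻¹ : Rˣ)) ^ 3,
    (hw.mul (i⁻¹).isUnit).pow 3, ?_⟩
  · rw [torsionChange_smul hc₄ hr]
    refine isIntegral_of_exists_lift R ⟨a, ?_⟩ ⟨0, map_zero _⟩ ⟨(a ^ 3 - 1) * (i⁻¹ : Rˣ), ?_⟩
      ⟨0, map_zero _⟩ ⟨0, map_zero _⟩
    · simp only [Units.val_inv_eq_inv_val, Units.val_mk0, ha, hx]
      field_simp
    · simp only [Units.val_inv_eq_inv_val, Units.val_mk0, map_mul, map_sub, map_pow, ha, map_one,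
        hi27, ← hb, hbx]
      field_simp
  · rw [variableChange_Δ]
    simp only [torsionChange, Units.val_inv_eq_inv_val, Units.val_mk0, map_mul, map_sub, map_pow,
      ha, map_one, hi27, hΔx]
    field_simp

end RationalPoint

/-! ### Application over finite extensions of `ℚ_2`. -/

section Local

variable {K : Type*} [Field K] [Algebra ℚ_[2] K] [Algebra ℤ_[2] K] [IsScalarTower ℤ_[2] ℚ_[2] K]

theorem IsPotentiallyGood2.isIntegral_j {E : WeierstrassCurve K} (h : E.IsPotentiallyGood2) :
    _root_.IsIntegral ℤ_[2] (E.c₄ ^ 3 / E.Δ) := by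
  obtain ⟨F, hF, C, hC⟩ := h
  have := isScalarTower_intermediateField F
  obtain ⟨j, hj⟩ := hC.exists_c₄_cube_div_Δ
  have hj' : _root_.IsIntegral ℤ_[2] (j : F) := j.2
  have h1 : (j : F) = algebraMap K F (E.c₄ ^ 3 / E.Δ) := by
    rw [map_div₀, map_pow]
    simp only [baseChange, map_c₄, map_Δ] at hj
    exact hj
  rw [h1] at hj'
  have : IsScalarTower ℤ_[2] K F := inferInstance
  exact (isIntegral_algebraMap_iff (algebraMap K F).injective).mp hj'

/-- An elliptic curve over a finite extension of `ℚ_2` with additive, potentially good reduction and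
cube discriminant has no rational point of order three. -/
theorem not_isGammaRoot_of_cube [FiniteDimensional ℚ_[2] K] {E : WeierstrassCurve K}
    (hadd : E.IsAdditive2) (hpot : E.IsPotentiallyGood2) (hΔ : E.Δ ≠ 0) (hc₄ : E.c₄ ≠ 0)
    (hcube : ∃ d : K, d ^ 3 = E.Δ) (r : K) : ¬ E.IsGammaRoot r := by
  intro hr
  have : CharZero K := charZero_of_injective_algebraMap (algebraMap ℚ_[2] K).injective
  obtain ⟨d, hd⟩ := hcube
  obtain ⟨D, hD⟩ := hadd
  have h3 : IsUnit (3 : integralClosure ℤ_[2] K) := by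
    have h : IsUnit (3 : ℤ_[2]) := by
      rw [PadicInt.isUnit_iff]
      exact_mod_cast PadicInt.norm_natCast_eq_one_iff.mpr (by norm_num : Nat.Coprime 2 3)
    have h' := h.map (algebraMap ℤ_[2] (integralClosure ℤ_[2] K))
    rwa [map_ofNat] at h'
  have hj : algebraMap (integralClosure ℤ_[2] K) K ⟨_, hpot.isIntegral_j⟩ = E.c₄ ^ 3 / E.Δ := rfl
  obtain ⟨C, hC, u, hu, hCu⟩ := exists_isIntegral_isUnit_of_isGammaRoot h3 hΔ hc₄ hr hd hj
  exact not_hasAdditiveReduction_of_isUnit hC hu hCu hD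

end Local

end WeierstrassCurve

/-! ### Subgroups of `GL(2, 𝔽₃)` -/

namespace GL2F3

set_option maxRecDepth 20000

/-- The `2 × 2` matrices over `𝔽₃`. -/
abbrev Mat := Matrix (Fin 2) (Fin 2) (ZMod 3)

/-- The group `GL(2, 𝔽₃)`. -/
abbrev Grp := GL (Fin 2) (ZMod 3)

/-- The nonzero vectors of `𝔽₃²` split into `H`-orbits of sizes `m`. -/
def HasOrbitSizes (H : Subgroup Grp) (m : Multiset ℕ) : Prop :=
  ∃ P : Multiset (Finset (Fin 2 → ZMod 3)),
    (∀ O ∈ P, ∃ v, ∀ y, y ∈ O ↔ ∃ g ∈ H, g.1.mulVec v = y) ∧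
    (P.map Finset.val).sum = (Finset.univ.erase (0 : Fin 2 → ZMod 3)).val ∧
    P.map Finset.card = m

/-- The matrices of the elements of a subgroup. -/
def matrices (H : Subgroup Grp) : Submonoid Mat := H.toSubmonoid.map (Units.coeHom Mat)

variable {H : Subgroup Grp}

theorem mem_matrices {A : Mat} : A ∈ matrices H ↔ ∃ g ∈ H, g.1 = A := Iff.rfl

theorem coe_mem_matrices {g : Grp} : g.1 ∈ matrices H ↔ g ∈ H :=
  ⟨fun ⟨_, hg', h⟩ => Units.ext h ▸ hg', fun h => ⟨g, h, rfl⟩⟩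

theorem det_eq_of_mem {A : Mat} (hA : A ∈ matrices H) : A.det = 1 ∨ A.det = -1 := by
  obtain ⟨g, -, rfl⟩ := hA
  exact WeierstrassCurve.det_eq_one_or_neg_one g

theorem exists_coe_eq {A : Mat} (hA : A.det ≠ 0) : ∃ g : Grp, g.1 = A :=
  (Matrix.isUnit_iff_isUnit_det A).mpr (isUnit_iff_ne_zero.mpr hA)

theorem card_grp : Nat.card Grp = 48 := by
  rw [Matrix.card_GL_field]
  simp [Fin.prod_univ_two, ZMod.card]

theorem card_dvd_sixteen (h3 : ¬ 3 ∣ Nat.card H) : Nat.card H ∣ 16 := by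
  have h1 : Nat.card H ∣ 3 * 16 := by
    have := Subgroup.card_subgroup_dvd_card H
    rwa [card_grp] at this
  exact Nat.Coprime.dvd_of_dvd_mul_left
    ((Nat.Prime.coprime_iff_not_dvd Nat.prime_three).mpr h3).symm h1

/-- Turns the condition on the order of `H` into one that can be decided matrix by matrix. -/
theorem pow_sixteen_of_mem (h3 : ¬ 3 ∣ Nat.card H) {A : Mat} (hA : A ∈ matrices H) :
    A ^ 16 = 1 := by
  obtain ⟨g, hg, rfl⟩ := hA
  obtain ⟨k, hk⟩ := card_dvd_sixteen h3
  have : (⟨g, hg⟩ : H) ^ 16 = 1 := by rw [hk, pow_mul, pow_card_eq_one', one_pow]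
  have h' : g ^ 16 = 1 := congrArg Subtype.val this
  change g.1 ^ 16 = 1
  rw [← Units.val_pow_eq_pow_val, h', Units.val_one]

theorem forall_matrix {p : Mat → Prop} (h : ∀ a b c d : ZMod 3, p !![a, b; c, d]) (A : Mat) :
    p A := by
  rw [Matrix.eta_fin_two A]
  exact h _ _ _ _

theorem nonempty_mulEquiv {X : Type*} [Group X] (f : X →* Mat) (hf : Function.Injective f)
    (hsub : ∀ x, f x ∈ matrices H) (hsup : ∀ A ∈ matrices H, ∃ x, f x = A) :
    Nonempty (H ≃* X) := by
  let F : X →* H := f.toHomUnits.codRestrict H fun x => coe_mem_matrices.mp (hsub x)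
  have hF : Function.Bijective F := by
    constructor
    · intro x y hxy
      exact hf (congrArg (fun g : H => g.1.1) hxy)
    · rintro ⟨g, hg⟩
      obtain ⟨x, hx⟩ := hsup g.1 (coe_mem_matrices.mpr hg)
      exact ⟨x, Subtype.ext (Units.ext hx)⟩
  exact ⟨(MulEquiv.ofBijective F hF).symm⟩

theorem hasOrbitSizes_of_param {X : Type*} [Group X] [Fintype X] (f : X →* Mat)
    (hsub : ∀ x, f x ∈ matrices H) (hsup : ∀ A ∈ matrices H, ∃ x, f x = A)
    (R : Multiset (Fin 2 → ZMod 3))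
    (hR : ((R.map fun v => Finset.univ.image fun x => (f x).mulVec v).map Finset.val).sum =
      (Finset.univ.erase (0 : Fin 2 → ZMod 3)).val) :
    HasOrbitSizes H
      ((R.map fun v => Finset.univ.image fun x => (f x).mulVec v).map Finset.card) := by
  refine ⟨_, fun O hO => ?_, hR, rfl⟩
  obtain ⟨v, -, rfl⟩ := Multiset.mem_map.mp hO
  refine ⟨v, fun y => ?_⟩
  simp only [Finset.mem_image, Finset.mem_univ, true_and]
  constructor
  · rintro ⟨x, rfl⟩
    obtain ⟨g, hg, hgx⟩ := hsub x
    exact ⟨g, hg, by rw [← hgx]; rfl⟩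
  · rintro ⟨g, hg, rfl⟩
    obtain ⟨x, hx⟩ := hsup g.1 (coe_mem_matrices.mpr hg)
    exact ⟨x, by rw [hx]⟩

/-- Once `H` is the image of an explicit finite group, both claims become computations. `R` lists
one vector per orbit; `hR` checks that these orbits partition the nonzero vectors. -/
theorem of_param {X : Type*} [Group X] [Fintype X] (f : X →* Mat) (hf : Function.Injective f)
    (hsub : ∀ x, f x ∈ matrices H) (hsup : ∀ A ∈ matrices H, ∃ x, f x = A)
    (R : Multiset (Fin 2 → ZMod 3))
    (hR : ((R.map fun v => Finset.univ.image fun x => (f x).mulVec v).map Finset.val).sum =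
      (Finset.univ.erase (0 : Fin 2 → ZMod 3)).val) {m : Multiset ℕ}
    (hm : (R.map fun v => Finset.univ.image fun x => (f x).mulVec v).map Finset.card = m) :
    HasOrbitSizes H m ∧ Nonempty (H ≃* X) :=
  ⟨hm ▸ hasOrbitSizes_of_param f hsub hsup R hR, nonempty_mulEquiv f hf hsub hsup⟩

theorem hasOrbitSizes_of_transitive
    (h : ∀ y : Fin 2 → ZMod 3, y ≠ 0 → ∃ A ∈ matrices H, A.mulVec ![1, 0] = y) :
    HasOrbitSizes H {8} := by
  refine ⟨{Finset.univ.erase 0}, fun O hO => ⟨![1, 0], fun y => ?_⟩, by simp, by decide⟩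
  rw [Multiset.mem_singleton.mp hO]
  simp only [Finset.mem_erase, Finset.mem_univ, and_true]
  constructor
  · intro hy
    obtain ⟨_, ⟨g, hg, rfl⟩, hgy⟩ := h y hy
    exact ⟨g, hg, hgy⟩
  · rintro ⟨g, -, rfl⟩ h0
    have := congrArg (g⁻¹).1.mulVec h0
    rw [Matrix.mulVec_mulVec, ← Units.val_mul, inv_mul_cancel, Units.val_one, Matrix.one_mulVec,
      Matrix.mulVec_zero] at this
    exact absurd this (by decide)

/-- An element of order three. -/
abbrev matU : Mat := !![1, 1; 0, 1]
/-- The transpose of `matU`. -/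
abbrev matL : Mat := !![1, 0; 1, 1]
/-- An element of order four. -/
abbrev matI : Mat := !![0, 1; -1, 0]
/-- An element of order four anticommuting with `matI`. -/
abbrev matJ : Mat := !![1, 1; 1, -1]
/-- An element of order eight. -/
abbrev matR : Mat := !![1, 1; -1, 1]
/-- A reflection. -/
abbrev matS : Mat := !![1, 0; 0, -1]
/-- The opposite reflection. -/
abbrev matS' : Mat := !![-1, 0; 0, 1]

/-- The homomorphism from a cyclic group of order `n` to matrices given by the powers of `A`. -/
def cyclicHom (n : ℕ) [NeZero n] (A : Mat) (hA : A ^ n = 1) : Multiplicative (ZMod n) →* Mat where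
  toFun i := A ^ (Multiplicative.toAdd i).val
  map_one' := by
    change A ^ (0 : ZMod n).val = 1
    rw [ZMod.val_zero, pow_zero]
  map_mul' x y := by
    rw [toAdd_mul, ZMod.val_add, ← pow_add, ← pow_eq_pow_mod _ hA]

theorem cyclicHom_mem {n : ℕ} [NeZero n] {A : Mat} (hA : A ^ n = 1) (h : A ∈ matrices H)
    (x : Multiplicative (ZMod n)) : cyclicHom n A hA x ∈ matrices H :=
  pow_mem h _

/-- The homomorphism from the dihedral group of order `2n` to matrices given by a rotation and a
reflection. -/
def dihedralHom (n : ℕ) [NeZero n] (A S : Mat) (hA : A ^ n = 1) (hS : S * S = 1)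
    (hAS : A * S * A = S) : DihedralGroup n →* Mat where
  toFun
    | .r i => A ^ i.val
    | .sr i => S * A ^ i.val
  map_one' := by
    change A ^ (0 : ZMod n).val = 1
    rw [ZMod.val_zero, pow_zero]
  map_mul' := by
    have hadd : ∀ i j : ZMod n, A ^ (i + j).val = A ^ i.val * A ^ j.val := fun i j => by
      rw [ZMod.val_add, ← pow_add, ← pow_eq_pow_mod _ hA]
    have hpow : ∀ k : ℕ, A ^ k * S * A ^ k = S := by
      intro k
      induction k with
      | zero => simp
      | succ k ih =>
        calc A ^ (k + 1) * S * A ^ (k + 1) = A ^ k * (A * S * A) * A ^ k := by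
              nth_rewrite 1 [pow_succ]
              rw [pow_succ']
              simp only [mul_assoc]
          _ = S := by rw [hAS, ih]
    have hcomm : ∀ i j : ZMod n, A ^ i.val * (S * A ^ j.val) = S * A ^ (j - i).val := by
      intro i j
      conv_lhs => rw [show j = i + (j - i) by ring, hadd, ← mul_assoc, ← mul_assoc, hpow]
    rintro (i | i) (j | j)
    · simp only [DihedralGroup.r_mul_r, hadd]
    · simp only [DihedralGroup.r_mul_sr, hcomm]
    · simp only [DihedralGroup.sr_mul_r, hadd, mul_assoc]
    · simp only [DihedralGroup.sr_mul_sr]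
      rw [mul_assoc, hcomm, ← mul_assoc, hS, one_mul]

theorem dihedralHom_mem {n : ℕ} [NeZero n] {A S : Mat} (hA : A ^ n = 1) (hS : S * S = 1)
    (hAS : A * S * A = S) (h : A ∈ matrices H) (h' : S ∈ matrices H) (x : DihedralGroup n) :
    dihedralHom n A S hA hS hAS x ∈ matrices H := by
  rcases x with i | i
  exacts [pow_mem h _, mul_mem h' (pow_mem h _)]

/-- The embedding of the quaternion group of order eight. -/
def quaternionHom : QuaternionGroup 2 →* Mat where
  toFun
    | .a i => matI ^ i.val
    | .xa i => matJ * matI ^ i.val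
  map_one' := by decide
  map_mul' := by decide

/-- The embedding of the Klein four-group as diagonal matrices. -/
def kleinHom : Multiplicative (ZMod 2) × Multiplicative (ZMod 2) →* Mat where
  toFun x := (-1) ^ (Multiplicative.toAdd x.1).val * matS ^ (Multiplicative.toAdd x.2).val
  map_one' := by decide
  map_mul' := by decide

/-! #### Standard subgroups -/

/-- The embedding of `{±1}`. -/
abbrev signHom := cyclicHom 2 (-1) (by decide)

/-- The embedding of the cyclic group of order four. -/
abbrev cyclicFourHom := cyclicHom 4 matI (by decide)

/-- The embedding of the cyclic group of order eight. -/
abbrev cyclicEightHom := cyclicHom 8 matR (by decide)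

/-- The embedding of the cyclic group of order three. -/
abbrev cyclicThreeHom := cyclicHom 3 matU (by decide)

/-- The embedding of the cyclic group of order six. -/
abbrev cyclicSixHom := cyclicHom 6 (-1 * matU) (by decide)

/-- The embedding of the dihedral group of order eight. -/
abbrev dihedralFourHom := dihedralHom 4 matI matS (by decide) (by decide) (by decide)

/-- The embedding of the dihedral group of order six fixing a vector. -/
abbrev dihedralThreeHom := dihedralHom 3 matU matS (by decide) (by decide) (by decide)

/-- The embedding of the dihedral group of order six fixing a quotient vector. -/
abbrev dihedralThreeHom' := dihedralHom 3 matU matS' (by decide) (by decide) (by decide)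

theorem of_two (hm : -1 ∈ matrices H) (hH : ∀ A ∈ matrices H, A = 1 ∨ A = -1) :
    HasOrbitSizes H {2, 2, 2, 2} ∧ Nonempty (H ≃* Multiplicative (ZMod 2)) := by
  have hsup : ∀ A ∈ matrices H, ∃ x, signHom x = A := fun A hA => by
    rcases hH A hA with rfl | rfl
    exacts [⟨1, by decide⟩, ⟨Multiplicative.ofAdd 1, by decide⟩]
  exact of_param signHom (by decide) (cyclicHom_mem (by decide) hm) hsup
    {![1, 0], ![0, 1], ![1, 1], ![1, -1]} (by decide) (by decide)

theorem of_cyclic_four (hI : matI ∈ matrices H)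
    (hH : ∀ A ∈ matrices H, A ∈ [1, -1, matI, -matI]) :
    HasOrbitSizes H {4, 4} ∧ Nonempty (H ≃* Multiplicative (ZMod 4)) := by
  have hl : ∀ A ∈ [1, -1, matI, -matI], ∃ x, cyclicFourHom x = A := by decide
  have hsup : ∀ A ∈ matrices H, ∃ x, cyclicFourHom x = A := fun A hA => hl A (hH A hA)
  exact of_param cyclicFourHom (by decide) (cyclicHom_mem (by decide) hI) hsup
    {![1, 0], ![1, 1]} (by decide) (by decide)

/-- The quaternion subgroup of order eight. -/
abbrev quaternionList : List Mat :=
  [1, -1, matI, -matI, matJ, -matJ, matI * matJ, -(matI * matJ)]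

theorem quaternionHom_mem (hI : matI ∈ matrices H) (hJ : matJ ∈ matrices H)
    (x : QuaternionGroup 2) : quaternionHom x ∈ matrices H := by
  rcases x with i | i
  exacts [pow_mem hI _, mul_mem hJ (pow_mem hI _)]

theorem of_quaternion (hI : matI ∈ matrices H) (hJ : matJ ∈ matrices H)
    (hH : ∀ A ∈ matrices H, A ∈ quaternionList) :
    HasOrbitSizes H {8} ∧ Nonempty (H ≃* QuaternionGroup 2) := by
  have hl : ∀ A ∈ quaternionList, ∃ x, quaternionHom x = A := by decide
  have hsup : ∀ A ∈ matrices H, ∃ x, quaternionHom x = A := fun A hA => hl A (hH A hA)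
  exact of_param quaternionHom (by decide) (quaternionHom_mem hI hJ) hsup
    {![1, 0]} (by decide) (by decide)

theorem of_klein (hm : -1 ∈ matrices H) (hS : matS ∈ matrices H)
    (hH : ∀ A ∈ matrices H, A ∈ [1, -1, matS, -matS]) :
    HasOrbitSizes H {2, 2, 4} ∧
      Nonempty (H ≃* Multiplicative (ZMod 2) × Multiplicative (ZMod 2)) := by
  have hl : ∀ A ∈ [1, -1, matS, -matS], ∃ x, kleinHom x = A := by decide
  have hsup : ∀ A ∈ matrices H, ∃ x, kleinHom x = A := fun A hA => hl A (hH A hA)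
  have hsub : ∀ x, kleinHom x ∈ matrices H := fun x => mul_mem (pow_mem hm _) (pow_mem hS _)
  exact of_param kleinHom (by decide) hsub hsup
    {![1, 0], ![0, 1], ![1, 1]} (by decide) (by decide)

theorem of_dihedral_four (hI : matI ∈ matrices H) (hS : matS ∈ matrices H)
    (hH : ∀ A ∈ matrices H,
      A ∈ [1, -1, matI, -matI, matS, -matS, matI * matS, -(matI * matS)]) :
    HasOrbitSizes H {4, 4} ∧ Nonempty (H ≃* DihedralGroup 4) := by
  have hl : ∀ A ∈ [1, -1, matI, -matI, matS, -matS, matI * matS, -(matI * matS)],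
    ∃ x, dihedralFourHom x = A := by decide
  have hsup : ∀ A ∈ matrices H, ∃ x, dihedralFourHom x = A :=
    fun A hA => hl A (hH A hA)
  have hsub : ∀ x, dihedralFourHom x ∈ matrices H := dihedralHom_mem _ _ _ hI hS
  exact of_param dihedralFourHom (by decide) hsub hsup
    {![1, 0], ![1, 1]} (by decide) (by decide)

theorem of_cyclic_eight (hR : matR ∈ matrices H) (hH : ∀ A ∈ matrices H, ∃ k < 8, A = matR ^ k) :
    Nonempty (H ≃* Multiplicative (ZMod 8)) := by
  have hsup : ∀ A ∈ matrices H, ∃ x, cyclicEightHom x = A := fun A hA => by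
    obtain ⟨k, hk, rfl⟩ := hH A hA
    exact ⟨Multiplicative.ofAdd (k : ZMod 8),
      by simp [cyclicHom, ZMod.val_natCast_of_lt hk]⟩
  exact nonempty_mulEquiv cyclicEightHom (by decide) (cyclicHom_mem (by decide) hR) hsup

/-- `matR` generates a copy of `𝔽₉ˣ`, which is simply transitive on nonzero vectors. -/
theorem hasOrbitSizes_of_matR (hR : matR ∈ matrices H) : HasOrbitSizes H {8} := by
  apply hasOrbitSizes_of_transitive
  have : ∀ y : Fin 2 → ZMod 3, y ≠ 0 → ∃ k < 8, (matR ^ k).mulVec ![1, 0] = y := by decide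
  intro y hy
  obtain ⟨k, -, hk⟩ := this y hy
  exact ⟨_, pow_mem hR k, hk⟩

theorem of_cyclic_three (hU : matU ∈ matrices H)
    (hH : ∀ A ∈ matrices H, A 1 0 = 0 ∧ A 0 0 = 1 ∧ A 1 1 = 1) :
    HasOrbitSizes H {1, 1, 3, 3} ∧ Nonempty (H ≃* Multiplicative (ZMod 3)) := by
  have hl : ∀ a b c d : ZMod 3, c = 0 ∧ a = 1 ∧ d = 1 →
    ∃ x, cyclicThreeHom x = !![a, b; c, d] := by decide
  have hsup : ∀ A ∈ matrices H, ∃ x, cyclicThreeHom x = A := fun A hA => by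
    rw [Matrix.eta_fin_two A]
    exact hl _ _ _ _ (hH A hA)
  exact of_param cyclicThreeHom (by decide) (cyclicHom_mem (by decide) hU) hsup
    {![1, 0], ![-1, 0], ![0, 1], ![0, -1]} (by decide) (by decide)

theorem of_cyclic_six (hU : matU ∈ matrices H) (hm : -1 ∈ matrices H)
    (hH : ∀ A ∈ matrices H, A 1 0 = 0 ∧ A 0 0 = A 1 1) :
    HasOrbitSizes H {2, 6} ∧ Nonempty (H ≃* Multiplicative (ZMod 6)) := by
  have hl : ∀ a b c d : ZMod 3, c = 0 ∧ a = d → a * d - b * c ≠ 0 →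
    ∃ x, cyclicSixHom x = !![a, b; c, d] := by decide
  have hsup : ∀ A ∈ matrices H, ∃ x, cyclicSixHom x = A := fun A hA => by
    have hdet := det_eq_of_mem hA
    rw [Matrix.det_fin_two] at hdet
    rw [Matrix.eta_fin_two A]
    exact hl _ _ _ _ (hH A hA) (by rcases hdet with h | h <;> rw [h] <;> decide)
  have hsub : ∀ x, cyclicSixHom x ∈ matrices H :=
    cyclicHom_mem _ (mul_mem hm hU)
  exact of_param cyclicSixHom (by decide) hsub hsup
    {![1, 0], ![0, 1]} (by decide) (by decide)

theorem of_dihedral_three (hU : matU ∈ matrices H) (hS : matS ∈ matrices H)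
    (hH : ∀ A ∈ matrices H, A 1 0 = 0 ∧ A 0 0 = 1) :
    HasOrbitSizes H {1, 1, 6} ∧ Nonempty (H ≃* DihedralGroup 3) := by
  have hl : ∀ a b c d : ZMod 3, c = 0 ∧ a = 1 → a * d - b * c ≠ 0 →
    ∃ x, dihedralThreeHom x = !![a, b; c, d] := by decide
  have hsup : ∀ A ∈ matrices H, ∃ x, dihedralThreeHom x = A := fun A hA => by
    have hdet := det_eq_of_mem hA
    rw [Matrix.det_fin_two] at hdet
    rw [Matrix.eta_fin_two A]
    exact hl _ _ _ _ (hH A hA) (by rcases hdet with h | h <;> rw [h] <;> decide)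
  have hsub : ∀ x, dihedralThreeHom x ∈ matrices H := dihedralHom_mem _ _ _ hU hS
  exact of_param dihedralThreeHom (by decide) hsub hsup
    {![1, 0], ![-1, 0], ![0, 1]} (by decide) (by decide)

/-- Here `H` acts trivially on the quotient by the stable line, not on the line itself; hence one
abstract group with two orbit patterns. -/
theorem of_dihedral_three' (hU : matU ∈ matrices H) (hS : matS' ∈ matrices H)
    (hH : ∀ A ∈ matrices H, A 1 0 = 0 ∧ A 1 1 = 1) :
    HasOrbitSizes H {2, 3, 3} ∧ Nonempty (H ≃* DihedralGroup 3) := by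
  have hl : ∀ a b c d : ZMod 3, c = 0 ∧ d = 1 → a * d - b * c ≠ 0 →
    ∃ x, dihedralThreeHom' x = !![a, b; c, d] := by decide
  have hsup : ∀ A ∈ matrices H, ∃ x, dihedralThreeHom' x = A := fun A hA => by
    have hdet := det_eq_of_mem hA
    rw [Matrix.det_fin_two] at hdet
    rw [Matrix.eta_fin_two A]
    exact hl _ _ _ _ (hH A hA) (by rcases hdet with h | h <;> rw [h] <;> decide)
  have hsub : ∀ x, dihedralThreeHom' x ∈ matrices H := dihedralHom_mem _ _ _ hU hS
  exact of_param dihedralThreeHom' (by decide) hsub hsup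
    {![1, 0], ![0, 1], ![0, -1]} (by decide) (by decide)

theorem hasOrbitSizes_borel : HasOrbitSizes borelGL2F3 {2, 6} := by
  have key : ∀ v y : Fin 2 → ZMod 3, (∃ g ∈ borelGL2F3, g.1.mulVec v = y) ↔
      ∃ a b d : ZMod 3, a * d ≠ 0 ∧ (!![a, b; 0, d] : Mat).mulVec v = y := by
    intro v y
    constructor
    · rintro ⟨g, hg, rfl⟩
      have h0 : g.1 1 0 = 0 := hg
      refine ⟨g.1 0 0, g.1 0 1, g.1 1 1, ?_, ?_⟩
      · have hdet := WeierstrassCurve.det_eq_one_or_neg_one g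
        rw [Matrix.det_fin_two, h0, mul_zero, sub_zero] at hdet
        rcases hdet with h | h <;> rw [h] <;> decide
      · rw [← h0, ← Matrix.eta_fin_two]
    · rintro ⟨a, b, d, had, rfl⟩
      obtain ⟨g, hg⟩ := exists_coe_eq (A := !![a, b; 0, d]) (by simpa [Matrix.det_fin_two] using had)
      exact ⟨g, by change g.1 1 0 = 0; rw [hg]; rfl, by rw [hg]⟩
  refine ⟨{{![1, 0], ![-1, 0]}, Finset.univ.filter fun v => v 1 ≠ 0}, fun O hO => ?_, by decide,
    by decide⟩
  simp only [Multiset.insert_eq_cons, Multiset.mem_cons, Multiset.mem_singleton] at hO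
  rcases hO with rfl | rfl
  · exact ⟨![1, 0], fun y => by rw [key]; revert y; decide⟩
  · exact ⟨![0, 1], fun y => by rw [key]; revert y; decide⟩

end GL2F3

namespace GL2F3

set_option maxRecDepth 20000

variable {H : Subgroup Grp}

/-! #### Subgroups containing an element of order three -/

theorem exists_order_three (h3 : 3 ∣ Nat.card H) : ∃ A ∈ matrices H, A ^ 3 = 1 ∧ A ≠ 1 := by
  have : Fact (Nat.Prime 3) := ⟨Nat.prime_three⟩
  obtain ⟨⟨g, hg⟩, hx⟩ := exists_prime_orderOf_dvd_card' 3 h3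
  rw [Subgroup.orderOf_mk] at hx
  refine ⟨g.1, coe_mem_matrices.mpr hg, ?_, fun h1 => ?_⟩
  · have h := pow_orderOf_eq_one g
    rw [hx] at h
    rw [← Units.val_pow_eq_pow_val, h, Units.val_one]
  · have h : g = 1 := Units.ext h1
    rw [h, orderOf_one] at hx
    exact absurd hx (by decide)

/-- In characteristic three `A³ = 1` gives `(A - 1)³ = 0`, so `A` is unipotent with a single Jordan
block. -/
theorem exists_conj_matU : ∀ A : Mat, A ^ 3 = 1 → A ≠ 1 → ∃ B : Mat, B.det ≠ 0 ∧ B * A = matU * B := by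
  apply forall_matrix
  have : ∀ a b c d : ZMod 3, (!![a, b; c, d] : Mat) ^ 3 = 1 → (!![a, b; c, d] : Mat) ≠ 1 →
      ∃ x y z w : ZMod 3, x * w - y * z ≠ 0 ∧
        !![x, y; z, w] * !![a, b; c, d] = matU * !![x, y; z, w] := by decide
  intro a b c d h1 h2
  obtain ⟨x, y, z, w, h, h'⟩ := this a b c d h1 h2
  exact ⟨_, by rwa [Matrix.det_fin_two_of], h'⟩

theorem matL_mem (hU : matU ∈ matrices H) {A : Mat} (hA : A ∈ matrices H) (hA0 : A 1 0 ≠ 0) :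
    matL ∈ matrices H := by
  -- As `c ≠ 0`, suitable powers of `matU` on both sides clear the diagonal. An antidiagonal `X` has
  -- `X⁴ = 1`, so `X * matU * X³` is a conjugate of `matU`, and it is lower unipotent.
  have key : ∀ a b c d : ZMod 3, c ≠ 0 → a * d - b * c ≠ 0 → ∃ i < 3, ∃ j < 3, ∃ k < 3,
      ((matU ^ i * !![a, b; c, d] * matU ^ j) * matU *
        (matU ^ i * !![a, b; c, d] * matU ^ j) ^ 3) ^ k = matL := by decide
  have hdet := det_eq_of_mem hA
  rw [Matrix.det_fin_two] at hdet
  obtain ⟨i, -, j, -, k, -, h⟩ := key _ _ _ _ hA0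
    (by rcases hdet with h | h <;> rw [h] <;> decide)
  rw [← Matrix.eta_fin_two] at h
  rw [← h]
  have hX : matU ^ i * A * matU ^ j ∈ matrices H :=
    mul_mem (mul_mem (pow_mem hU _) hA) (pow_mem hU _)
  exact pow_mem (mul_mem (mul_mem hX hU) (pow_mem hX _)) _

theorem mem_of_det_one (hU : matU ∈ matrices H) (hL : matL ∈ matrices H) {A : Mat}
    (hA : A.det = 1) : A ∈ matrices H := by
  have key : ∀ a b c d : ZMod 3, a * d - b * c = 1 → ∃ i < 3, ∃ j < 3, ∃ k < 3, ∃ l < 3,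
      matU ^ i * matL ^ j * matU ^ k * matL ^ l = !![a, b; c, d] := by decide
  rw [Matrix.det_fin_two] at hA
  obtain ⟨i, -, j, -, k, -, l, -, h⟩ := key _ _ _ _ hA
  rw [← Matrix.eta_fin_two] at h
  rw [← h]
  exact mul_mem (mul_mem (mul_mem (pow_mem hU _) (pow_mem hL _)) (pow_mem hU _)) (pow_mem hL _)

theorem hasOrbitSizes_of_matU_matL (hU : matU ∈ matrices H) (hL : matL ∈ matrices H) :
    HasOrbitSizes H {8} := by
  apply hasOrbitSizes_of_transitive
  have : ∀ y : Fin 2 → ZMod 3, y ≠ 0 → ∃ a b c d : ZMod 3, a * d - b * c = 1 ∧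
    (!![a, b; c, d] : Mat).mulVec ![1, 0] = y := by decide
  intro y hy
  obtain ⟨a, b, c, d, h, h'⟩ := this y hy
  exact ⟨_, mem_of_det_one hU hL (by rwa [Matrix.det_fin_two_of]), h'⟩

theorem nonempty_mulEquiv_SL (hU : matU ∈ matrices H) (hL : matL ∈ matrices H)
    (hdet : ∀ A ∈ matrices H, A.det = 1) :
    Nonempty (H ≃* Matrix.SpecialLinearGroup (Fin 2) (ZMod 3)) :=
  nonempty_mulEquiv ((Units.coeHom Mat).comp Matrix.SpecialLinearGroup.toGL)
    (fun _ _ h => Subtype.ext h) (fun x => mem_of_det_one hU hL x.2)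
    (fun A hA => ⟨⟨A, hdet A hA⟩, rfl⟩)

theorem mem_of_matU_matL_det (hU : matU ∈ matrices H) (hL : matL ∈ matrices H) {B : Mat}
    (hB : B ∈ matrices H) (hdet : B.det = -1) (g : Grp) : g ∈ H := by
  rw [← coe_mem_matrices]
  rcases WeierstrassCurve.det_eq_one_or_neg_one g with h | h
  · exact mem_of_det_one hU hL h
  · obtain ⟨b, hb, rfl⟩ := hB
    have h1 : g.1 * (b⁻¹).1 ∈ matrices H := by
      apply mem_of_det_one hU hL
      have h2 : b.1.det * (b⁻¹).1.det = 1 := by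
        rw [← Matrix.det_mul, ← Units.val_mul, mul_inv_cancel, Units.val_one, Matrix.det_one]
      change b.1.det = -1 at hdet
      rw [Matrix.det_mul, h, ← hdet, h2]
    have h2 := mul_mem h1 (coe_mem_matrices.mpr hb)
    rwa [mul_assoc, ← Units.val_mul, inv_mul_cancel, Units.val_one, mul_one] at h2

theorem nonempty_mulEquiv_GL (h : ∀ g, g ∈ H) : Nonempty (H ≃* GL (Fin 2) (ZMod 3)) := by
  have : H = ⊤ := (Subgroup.eq_top_iff' H).mpr h
  exact ⟨(MulEquiv.subgroupCongr this).trans Subgroup.topEquiv⟩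

/-- A power of `matU` clears the upper right entry, so a Borel-type `H` is determined by its
diagonal matrices. -/
theorem diag_mem (hU : matU ∈ matrices H) {A : Mat} (hA : A ∈ matrices H) (h0 : A 1 0 = 0) :
    !![A 0 0, 0; 0, A 1 1] ∈ matrices H := by
  have key : ∀ a b d : ZMod 3, a * d - b * 0 ≠ 0 → ∃ i < 3,
      !![a, b; 0, d] * matU ^ i = !![a, 0; 0, d] := by decide
  have hdet := det_eq_of_mem hA
  rw [Matrix.det_fin_two, h0] at hdet
  obtain ⟨i, -, h⟩ := key (A 0 0) (A 0 1) (A 1 1)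
    (by rcases hdet with h | h <;> rw [h] <;> decide)
  rw [← h, ← h0, ← Matrix.eta_fin_two]
  exact mul_mem hA (pow_mem hU _)

/-- Subgroups of `SL(2, 𝔽₃)` containing a unipotent matrix. -/
theorem of_matU_of_det_one (hU : matU ∈ matrices H) (hdet : ∀ A ∈ matrices H, A.det = 1) :
    (HasOrbitSizes H {1, 1, 3, 3} ∧ Nonempty (H ≃* Multiplicative (ZMod 3))) ∨
    (HasOrbitSizes H {2, 6} ∧ Nonempty (H ≃* Multiplicative (ZMod 6))) ∨
    (HasOrbitSizes H {8} ∧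
      Nonempty (H ≃* Matrix.SpecialLinearGroup (Fin 2) (ZMod 3))) := by
  by_cases hbor : ∀ A ∈ matrices H, A 1 0 = 0
  · have hd : ∀ a d : ZMod 3, a * d = 1 → a = 1 ∧ d = 1 ∨ a = -1 ∧ d = -1 := by decide
    have hA : ∀ A ∈ matrices H, A 0 0 = 1 ∧ A 1 1 = 1 ∨ A 0 0 = -1 ∧ A 1 1 = -1 := fun A hA => by
      apply hd
      have := hdet A hA
      rwa [Matrix.det_fin_two, hbor A hA, mul_zero, sub_zero] at this
    by_cases hm : -1 ∈ matrices H
    · refine Or.inr (Or.inl (of_cyclic_six hU hm fun A hA' => ⟨hbor A hA', ?_⟩))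
      rcases hA A hA' with ⟨h, h'⟩ | ⟨h, h'⟩ <;> rw [h, h']
    · refine Or.inl (of_cyclic_three hU fun A hA' => ⟨hbor A hA', ?_⟩)
      refine (hA A hA').resolve_right fun h => hm ?_
      have := diag_mem hU hA' (hbor A hA')
      rw [h.1, h.2] at this
      convert this using 1
      decide
  · push Not at hbor
    obtain ⟨A, hA, h0⟩ := hbor
    have hL := matL_mem hU hA h0
    exact Or.inr (Or.inr ⟨hasOrbitSizes_of_matU_matL hU hL, nonempty_mulEquiv_SL hU hL hdet⟩)

/-- Subgroups of `GL(2, 𝔽₃)` not contained in `SL(2, 𝔽₃)` and containing a unipotent matrix. -/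
theorem of_matU_of_det_neg_one (hU : matU ∈ matrices H) {B : Mat} (hB : B ∈ matrices H)
    (hdet : B.det = -1) :
    (HasOrbitSizes H {1, 1, 6} ∧ Nonempty (H ≃* DihedralGroup 3)) ∨
    (HasOrbitSizes H {2, 3, 3} ∧ Nonempty (H ≃* DihedralGroup 3)) ∨
    (HasOrbitSizes H {2, 6} ∧ Nonempty (H ≃* borelGL2F3)) ∨
    (HasOrbitSizes H {8} ∧ Nonempty (H ≃* GL (Fin 2) (ZMod 3))) := by
  by_cases hbor : ∀ A ∈ matrices H, A 1 0 = 0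
  · have hd : ∀ a d : ZMod 3, a * d = 1 ∨ a * d = -1 → a = 1 ∧ d = 1 ∨ a = -1 ∧ d = -1 ∨
        a = 1 ∧ d = -1 ∨ a = -1 ∧ d = 1 := by decide
    have hA : ∀ A ∈ matrices H, A 0 0 = 1 ∧ A 1 1 = 1 ∨ A 0 0 = -1 ∧ A 1 1 = -1 ∨
        A 0 0 = 1 ∧ A 1 1 = -1 ∨ A 0 0 = -1 ∧ A 1 1 = 1 := fun A hA => by
      apply hd
      have := det_eq_of_mem hA
      rwa [Matrix.det_fin_two, hbor A hA, mul_zero, sub_zero] at this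
    have hdiag : ∀ A ∈ matrices H, ∀ a d, A 0 0 = a ∧ A 1 1 = d → !![a, 0; 0, d] ∈ matrices H := by
      rintro A hA _ _ ⟨rfl, rfl⟩
      exact diag_mem hU hA (hbor A hA)
    have e : matS * matS' = -1 := by decide
    have eS : matS * -1 = matS' := by decide
    have eS' : matS' * -1 = matS := by decide
    have em : (!![-1, 0; 0, -1] : Mat) = -1 := by decide
    -- The diagonal matrices in `H` form a subgroup of `{±1}²` not contained in `{±1}`: everything,
    -- or generated by one of the two reflections.
    by_cases hS : matS ∈ matrices H
    · by_cases hS' : matS' ∈ matrices H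
      · have hH : H = borelGL2F3 := by
          apply le_antisymm
          · exact fun g hg => hbor g.1 (coe_mem_matrices.mpr hg)
          · intro g hg
            have h0 : g.1 1 0 = 0 := hg
            have hdet := WeierstrassCurve.det_eq_one_or_neg_one g
            rw [Matrix.det_fin_two, h0] at hdet
            have key : ∀ a b d : ZMod 3, (a * d - b * 0 = 1 ∨ a * d - b * 0 = -1) →
                ∃ i < 2, ∃ j < 2, ∃ k < 3, matS ^ i * matS' ^ j * matU ^ k = !![a, b; 0, d] := by
              decide
            obtain ⟨i, -, j, -, k, -, h⟩ := key _ _ _ hdet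
            rw [← coe_mem_matrices, Matrix.eta_fin_two g.1, h0, ← h]
            exact mul_mem (mul_mem (pow_mem hS _) (pow_mem hS' _)) (pow_mem hU _)
        subst hH
        exact Or.inr (Or.inr (Or.inl ⟨hasOrbitSizes_borel, ⟨MulEquiv.refl _⟩⟩))
      · refine Or.inl (of_dihedral_three hU hS fun A hA' => ⟨hbor A hA', ?_⟩)
        rcases hA A hA' with h | h | h | h
        · exact h.1
        · have := hdiag A hA' _ _ h
          rw [em] at this
          exact absurd (eS ▸ mul_mem hS this) hS'
        · exact h.1
        · exact absurd (hdiag A hA' _ _ h) hS'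
    · have hS' : matS' ∈ matrices H := by
        rcases hA B hB with h | h | h | h
        · rw [Matrix.det_fin_two, hbor B hB, h.1, h.2] at hdet
          exact absurd hdet (by simp; decide)
        · rw [Matrix.det_fin_two, hbor B hB, h.1, h.2] at hdet
          exact absurd hdet (by simp; decide)
        · exact absurd (hdiag B hB _ _ h) hS
        · exact hdiag B hB _ _ h
      refine Or.inr (Or.inl (of_dihedral_three' hU hS' fun A hA' => ⟨hbor A hA', ?_⟩))
      rcases hA A hA' with h | h | h | h
      · exact h.2
      · have := hdiag A hA' _ _ h
        rw [em] at this
        exact absurd (eS' ▸ mul_mem hS' this) hS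
      · exact absurd (hdiag A hA' _ _ h) hS
      · exact h.2
  · push Not at hbor
    obtain ⟨A, hA, h0⟩ := hbor
    have hL := matL_mem hU hA h0
    exact Or.inr (Or.inr (Or.inr ⟨hasOrbitSizes_of_matU_matL hU hL,
      nonempty_mulEquiv_GL (mem_of_matU_matL_det hU hL hB hdet)⟩))

/-! #### Subgroups of order prime to three -/

/-- The elements of two-power order in `SL(2, 𝔽₃)` are those of its normal Sylow subgroup `Q₈`. -/
theorem mem_quaternionList (h3 : ¬ 3 ∣ Nat.card H) {A : Mat} (hA : A ∈ matrices H)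
    (hdet : A.det = 1) : A ∈ quaternionList := by
  have key : ∀ a b c d : ZMod 3, a * d - b * c = 1 → !![a, b; c, d] ^ 16 = 1 →
      !![a, b; c, d] ∈ quaternionList := by decide
  have h16 := pow_sixteen_of_mem h3 hA
  rw [Matrix.det_fin_two] at hdet
  rw [Matrix.eta_fin_two A] at h16 ⊢
  exact key _ _ _ _ hdet h16

theorem exists_conj_matI : ∀ A : Mat, A.det = 1 → A * A = -1 →
    ∃ B : Mat, B.det ≠ 0 ∧ B * A = matI * B := by
  apply forall_matrix
  have : ∀ a b c d : ZMod 3, a * d - b * c = 1 →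
      (!![a, b; c, d] : Mat) * !![a, b; c, d] = -1 →
      ∃ x y z w : ZMod 3, x * w - y * z ≠ 0 ∧
        !![x, y; z, w] * !![a, b; c, d] = matI * !![x, y; z, w] := by decide
  intro a b c d h1 h2
  rw [Matrix.det_fin_two_of] at h1
  obtain ⟨x, y, z, w, h, h'⟩ := this a b c d h1 h2
  exact ⟨_, by rwa [Matrix.det_fin_two_of], h'⟩

/-- Subgroups of `SL(2, 𝔽₃)` of order prime to three without elements of order four. -/
theorem of_det_one_of_forall (h3 : ¬ 3 ∣ Nat.card H) (hdet : ∀ A ∈ matrices H, A.det = 1)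
    (hfix : ∃ A ∈ matrices H, A.mulVec ![1, 0] ≠ ![1, 0])
    (h4 : ∀ A ∈ matrices H, A * A ≠ -1) :
    HasOrbitSizes H {2, 2, 2, 2} ∧ Nonempty (H ≃* Multiplicative (ZMod 2)) := by
  have key : ∀ A ∈ quaternionList, A * A ≠ -1 → A = 1 ∨ A = -1 := by decide
  have hH : ∀ A ∈ matrices H, A = 1 ∨ A = -1 := fun A hA =>
    key A (mem_quaternionList h3 hA (hdet A hA)) (h4 A hA)
  obtain ⟨A, hA, hA1⟩ := hfix
  refine of_two ?_ hH
  rcases hH A hA with rfl | rfl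
  · exact absurd (Matrix.one_mulVec _) hA1
  · exact hA

/-- Subgroups of `SL(2, 𝔽₃)` of order prime to three with an element of order four. -/
theorem of_det_one_of_matI (h3 : ¬ 3 ∣ Nat.card H) (hdet : ∀ A ∈ matrices H, A.det = 1)
    (hI : matI ∈ matrices H) :
    (HasOrbitSizes H {4, 4} ∧ Nonempty (H ≃* Multiplicative (ZMod 4))) ∨
    (HasOrbitSizes H {8} ∧ Nonempty (H ≃* QuaternionGroup 2)) := by
  have hQ : ∀ A ∈ matrices H, A ∈ quaternionList := fun A hA =>
    mem_quaternionList h3 hA (hdet A hA)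
  by_cases h : ∀ A ∈ matrices H, A ∈ [1, -1, matI, -matI]
  · exact Or.inl (of_cyclic_four hI h)
  · push Not at h
    obtain ⟨A, hA, hA'⟩ := h
    -- Outside `⟨matI⟩` there is a single coset, that of `matJ`.
    have key : ∀ A ∈ quaternionList, A ∉ [1, -1, matI, -matI] → ∃ k < 4, matI ^ k * A = matJ := by
      decide
    obtain ⟨k, -, hk⟩ := key A (hQ A hA) hA'
    exact Or.inr (of_quaternion hI (hk ▸ mul_mem (pow_mem hI k) hA) hQ)

/-- Such an `A` has trace `±1` and order eight. The trace determines the conjugacy class, and `A⁵ =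
-A` switches its sign. -/
theorem exists_conj_matR : ∀ A : Mat, A.det = -1 → A * A ≠ 1 →
    ∃ B : Mat, B.det ≠ 0 ∧ (B * A = matR * B ∨ B * A ^ 5 = matR * B) := by
  apply forall_matrix
  have : ∀ a b c d : ZMod 3, a * d - b * c = -1 →
      (!![a, b; c, d] : Mat) * !![a, b; c, d] ≠ 1 →
      ∃ x y z w : ZMod 3, x * w - y * z ≠ 0 ∧
        (!![x, y; z, w] * !![a, b; c, d] = matR * !![x, y; z, w] ∨
          !![x, y; z, w] * !![a, b; c, d] ^ 5 = matR * !![x, y; z, w]) := by decide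
  intro a b c d h1 h2
  rw [Matrix.det_fin_two_of] at h1
  obtain ⟨x, y, z, w, h, h'⟩ := this a b c d h1 h2
  exact ⟨_, by rwa [Matrix.det_fin_two_of], h'⟩

theorem exists_conj_matS : ∀ A : Mat, A.det = -1 → A * A = 1 →
    ∃ B : Mat, B.det ≠ 0 ∧ B * A = matS * B := by
  apply forall_matrix
  have : ∀ a b c d : ZMod 3, a * d - b * c = -1 →
      (!![a, b; c, d] : Mat) * !![a, b; c, d] = 1 →
      ∃ x y z w : ZMod 3, x * w - y * z ≠ 0 ∧
        !![x, y; z, w] * !![a, b; c, d] = matS * !![x, y; z, w] := by decide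
  intro a b c d h1 h2
  rw [Matrix.det_fin_two_of] at h1
  obtain ⟨x, y, z, w, h, h'⟩ := this a b c d h1 h2
  exact ⟨_, by rwa [Matrix.det_fin_two_of], h'⟩

/-- Subgroups of order prime to three with an element of order eight. -/
theorem of_matR (h3 : ¬ 3 ∣ Nat.card H) (hR : matR ∈ matrices H) :
    HasOrbitSizes H {8} ∧ (Nonempty (H ≃* Multiplicative (ZMod 8)) ∨
      ∃ P : Sylow 2 (GL (Fin 2) (ZMod 3)), Nonempty (H ≃* P)) := by
  refine ⟨hasOrbitSizes_of_matR hR, ?_⟩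
  by_cases h : ∀ A ∈ matrices H, ∃ k < 8, A = matR ^ k
  · exact Or.inl (of_cyclic_eight hR h)
  · right
    obtain ⟨r, hr, hrR⟩ := hR
    change r.1 = matR at hrR
    have hord : orderOf r = 2 ^ 3 := by
      apply orderOf_eq_prime_pow
      · rw [Units.ext_iff, Units.val_pow_eq_pow_val, hrR]
        decide
      · rw [Units.ext_iff, Units.val_pow_eq_pow_val, hrR]
        decide
    have hle : Subgroup.zpowers r ≤ H := by simpa using hr
    have h8 : 8 ∣ Nat.card H := by
      have := Subgroup.card_dvd_of_le hle
      rwa [Nat.card_zpowers, hord] at this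
    have hne : Nat.card H ≠ 8 := by
      intro h8'
      have heq : Subgroup.zpowers r = H := by
        apply Subgroup.eq_of_le_of_card_ge hle
        rw [Nat.card_zpowers, hord, h8']
        norm_num
      apply h
      rintro _ ⟨g, hg, rfl⟩
      change g ∈ H at hg
      rw [← heq, ← mem_powers_iff_mem_zpowers] at hg
      obtain ⟨k, rfl⟩ := hg
      refine ⟨k % 2 ^ 3, Nat.mod_lt _ (by norm_num), ?_⟩
      change (r ^ k).1 = _
      rw [← hord, ← hrR, ← Units.val_pow_eq_pow_val, pow_mod_orderOf]
    have h16 : Nat.card H = 16 := by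
      have hd := card_dvd_sixteen h3
      obtain ⟨m, hm⟩ := h8
      have hle : Nat.card H ≤ 16 := Nat.le_of_dvd (by norm_num) hd
      have hpos : 0 < Nat.card H := Nat.card_pos
      have : m = 2 := by omega
      omega
    -- `16` is the full power of two in `48`, so `H` is itself a Sylow subgroup.
    have hS : Nat.card H = 2 ^ (Nat.card Grp).factorization 2 := by
      rw [h16, card_grp, show 48 = 2 ^ 4 * 3 by norm_num,
        Nat.factorization_mul (by norm_num) (by norm_num), Nat.Prime.factorization_pow
        Nat.prime_two, Nat.Prime.factorization Nat.prime_three]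
      simp
    exact ⟨Sylow.ofCard H hS, ⟨MulEquiv.refl _⟩⟩

/-- Subgroups of order prime to three, not contained in `SL(2, 𝔽₃)`, without elements of order
eight. -/
theorem of_matS (h3 : ¬ 3 ∣ Nat.card H) (hS : matS ∈ matrices H)
    (h8 : ∀ A ∈ matrices H, A.det = -1 → A * A = 1)
    (hfix : ∃ A ∈ matrices H, A.mulVec ![1, 0] ≠ ![1, 0]) :
    (HasOrbitSizes H {2, 2, 4} ∧
      Nonempty (H ≃* Multiplicative (ZMod 2) × Multiplicative (ZMod 2))) ∨
    (HasOrbitSizes H {4, 4} ∧ Nonempty (H ≃* DihedralGroup 4)) := by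
  have hdetS : matS.det = -1 := by rw [Matrix.det_fin_two]; decide
  have hSS : matS * matS = 1 := by decide
  have h1 : ∀ A ∈ matrices H, A.det = 1 → A ∈ [1, -1, matI, -matI] := by
    intro A hA hdet
    -- `A * matS` has determinant `-1`, hence is an involution, so `matS` inverts `A`. Within `Q₈`
    -- this holds only on `⟨matI⟩`.
    have key : ∀ A ∈ quaternionList, A * matS * (A * matS) = 1 → A ∈ [1, -1, matI, -matI] := by
      decide
    exact key A (mem_quaternionList h3 hA hdet)
      (h8 _ (mul_mem hA hS) (by rw [Matrix.det_mul, hdet, hdetS, one_mul]))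
  have h2 : ∀ A ∈ matrices H, ∃ B ∈ matrices H, B.det = 1 ∧ (A = B ∨ A = B * matS) := by
    intro A hA
    rcases det_eq_of_mem hA with h | h
    · exact ⟨A, hA, h, Or.inl rfl⟩
    · refine ⟨A * matS, mul_mem hA hS, ?_, Or.inr (by rw [mul_assoc, hSS, mul_one])⟩
      rw [Matrix.det_mul, h, hdetS]
      decide
  have hm : -1 ∈ matrices H := by
    obtain ⟨A, hA, hA1⟩ := hfix
    obtain ⟨B, hB, hdet, hAB⟩ := h2 A hA
    -- Both `1` and `matS` fix `![1, 0]`, so a matrix moving it has a nontrivial part of determinant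
    -- one, some power of which is `-1`.
    have hB1 : B ≠ 1 := by
      rintro rfl
      rcases hAB with rfl | rfl
      · exact hA1 (by decide)
      · exact hA1 (by decide)
    have key : ∀ B ∈ [1, -1, matI, -matI], B ≠ 1 → ∃ k < 3, B ^ k = -1 := by decide
    obtain ⟨k, -, hk⟩ := key B (h1 B hB hdet) hB1
    exact hk ▸ pow_mem hB k
  by_cases hI : matI ∈ matrices H
  · refine Or.inr (of_dihedral_four hI hS fun A hA => ?_)
    obtain ⟨B, hB, hdet, hAB⟩ := h2 A hA
    have key : ∀ B ∈ [1, -1, matI, -matI],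
        B ∈ [1, -1, matI, -matI, matS, -matS, matI * matS, -(matI * matS)] ∧
        B * matS ∈ [1, -1, matI, -matI, matS, -matS, matI * matS, -(matI * matS)] := by decide
    rcases hAB with rfl | rfl
    exacts [(key _ (h1 _ hB hdet)).1, (key _ (h1 _ hB hdet)).2]
  · refine Or.inl (of_klein hm hS fun A hA => ?_)
    obtain ⟨B, hB, hdet, hAB⟩ := h2 A hA
    have hB1 : B ∈ [1, -1] := by
      have key : ∀ B ∈ [1, -1, matI, -matI], B ∈ [1, -1] ∨ ∃ k < 4, B ^ k = matI := by decide
      refine (key B (h1 B hB hdet)).resolve_right ?_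
      rintro ⟨k, -, hk⟩
      exact hI (hk ▸ pow_mem hB k)
    have key : ∀ B ∈ [1, -1], B ∈ [1, -1, matS, -matS] ∧ B * matS ∈ [1, -1, matS, -matS] := by
      decide
    rcases hAB with rfl | rfl
    exacts [(key _ hB1).1, (key _ hB1).2]

end GL2F3

namespace WeierstrassCurve

open GL2F3

variable {K : Type*} [Field K] {E : WeierstrassCurve K} {L : Type*} [Field L] [Algebra K L]
  {ρ : (L ≃ₐ[K] L) →* GL (Fin 2) (ZMod 3)} {s : (Fin 2 → ZMod 3) → L}

/-! ### From the image of the representation to the factorisation of `γ` -/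

theorem mem_matrices_range {A : Mat} : A ∈ matrices ρ.range ↔ ∃ σ, (ρ σ).1 = A := by
  rw [mem_matrices]
  simp only [MonoidHom.mem_range]
  constructor
  · rintro ⟨_, ⟨σ, rfl⟩, h⟩
    exact ⟨σ, h⟩
  · rintro ⟨σ, h⟩
    exact ⟨_, ⟨σ, rfl⟩, h⟩

theorem IsGammaParam.roots_eq [CharZero K] (h : E.IsGammaParam ρ s) (hΔ : E.Δ ≠ 0)
    (hc₄ : E.c₄ ≠ 0) : (E.gammaPoly.map (algebraMap K L)).roots =
      (Finset.univ.erase (0 : Fin 2 → ZMod 3)).val.map s := by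
  have hsep := (gammaPoly_separable hΔ hc₄).map (f := algebraMap K L)
  refine (Multiset.Nodup.ext (nodup_roots hsep) ?_).mpr fun r => ?_
  · refine Multiset.Nodup.map_on (fun v hv w hw => ?_) (Finset.nodup _)
    simp only [Finset.mem_val, Finset.mem_erase, Finset.mem_univ, and_true] at hv hw
    exact h.injOn v w hv hw
  · have hroot := mem_rootSet_gammaPoly (E := E) r
    rw [mem_rootSet', aeval_def, ← eval_map] at hroot
    rw [mem_roots', IsRoot.def, hroot, Multiset.mem_map]
    simp only [Finset.mem_val, Finset.mem_erase, Finset.mem_univ, and_true]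
    exact ⟨h.surj r, fun ⟨v, hv, hr⟩ => hr ▸ h.isGammaRoot v hv⟩

/-- The parametrisation is injective on nonzero vectors and equivariant, so it carries orbits of
vectors to Galois orbits of roots of the same size. -/
theorem IsGammaParam.irreducibleFactorDegrees_eq [CharZero K]
    [E.gammaPoly.IsSplittingField K L] [FiniteDimensional K L] [IsGalois K L]
    (h : E.IsGammaParam ρ s) (hΔ : E.Δ ≠ 0) (hc₄ : E.c₄ ≠ 0) {m : Multiset ℕ}
    (hm : HasOrbitSizes ρ.range m) : irreducibleFactorDegrees E.gammaPoly = m := by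
  classical
  obtain ⟨P, hP, hsum, rfl⟩ := hm
  have hne : ∀ O ∈ P, ∀ v ∈ O, v ≠ 0 := fun O hO v hv => by
    have hle : O.val ≤ (P.map Finset.val).sum :=
      Multiset.single_le_sum (fun _ _ => Multiset.zero_le _) _ (Multiset.mem_map_of_mem _ hO)
    rw [hsum] at hle
    exact Finset.ne_of_mem_erase (Finset.mem_val.mp (Multiset.mem_of_le hle hv))
  have hinj : ∀ O ∈ P, Set.InjOn s O := fun O hO v hv w hw =>
    h.injOn v w (hne O hO v hv) (hne O hO w hw)
  rw [irreducibleFactorDegrees_eq_of_orbits (L := L) monic_gammaPoly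
    (IsSplittingField.splits L E.gammaPoly) (P.map (Finset.image s)), Multiset.map_map]
  · exact Multiset.map_congr rfl fun O hO => Finset.card_image_of_injOn (hinj O hO)
  · intro O hO
    obtain ⟨O, hO', rfl⟩ := Multiset.mem_map.mp hO
    obtain ⟨v, hv⟩ := hP O hO'
    refine ⟨s v, fun y => ?_⟩
    rw [Finset.mem_image]
    constructor
    · rintro ⟨w, hw, rfl⟩
      obtain ⟨_, ⟨σ, rfl⟩, hσ⟩ := (hv w).mp hw
      exact ⟨σ, by rw [h.equivariant, hσ]⟩
    · rintro ⟨σ, rfl⟩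
      exact ⟨_, (hv _).mpr ⟨_, ⟨σ, rfl⟩, rfl⟩, (h.equivariant σ v).symm⟩
  · rw [h.roots_eq hΔ hc₄, ← hsum, Multiset.map_map]
    have : P.map (Finset.val ∘ Finset.image s) = P.map (fun O => O.val.map s) :=
      Multiset.map_congr rfl fun O hO => Finset.image_val_of_injOn (hinj O hO)
    rw [this]
    change _ = Multiset.mapAddMonoidHom s _
    rw [map_multiset_sum, Multiset.map_map]
    rfl

theorem IsGammaParam.natCard_range [E.gammaPoly.IsSplittingField K L]
    (h : E.IsGammaParam ρ s) : Nat.card ρ.range = Nat.card (L ≃ₐ[K] L) :=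
  (Nat.card_congr (MonoidHom.ofInjective h.rep_injective).toEquiv).symm

theorem IsGammaParam.transfer [CharZero K] [E.gammaPoly.IsSplittingField K L]
    [FiniteDimensional K L] [IsGalois K L] (h : E.IsGammaParam ρ s) (hΔ : E.Δ ≠ 0)
    (hc₄ : E.c₄ ≠ 0) {m : Multiset ℕ} {X : Type*} [Group X]
    (hm : HasOrbitSizes ρ.range m ∧ Nonempty (ρ.range ≃* X)) :
    irreducibleFactorDegrees E.gammaPoly = m ∧ Nonempty ((L ≃ₐ[K] L) ≃* X) :=
  ⟨h.irreducibleFactorDegrees_eq hΔ hc₄ hm.1,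
    hm.2.map fun e => (MonoidHom.ofInjective h.rep_injective).trans e⟩

theorem IsGammaParam.exists_conj (h : E.IsGammaParam ρ s) {A B C : Mat}
    (hA : A ∈ matrices ρ.range) (hB : B.det ≠ 0) (hBA : B * A = C * B) :
    ∃ (ρ' : (L ≃ₐ[K] L) →* GL (Fin 2) (ZMod 3)) (s' : (Fin 2 → ZMod 3) → L),
      E.IsGammaParam ρ' s' ∧ C ∈ matrices ρ'.range := by
  obtain ⟨g, rfl⟩ := exists_coe_eq hB
  obtain ⟨σ, rfl⟩ := mem_matrices_range.mp hA
  refine ⟨_, _, h.conj g, mem_matrices_range.mpr ⟨σ, ?_⟩⟩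
  simp only [MonoidHom.coe_comp, Function.comp_apply, MulEquiv.coe_toMonoidHom, MulAut.conj_apply,
    Units.val_mul]
  rw [hBA, mul_assoc, ← Units.val_mul, mul_inv_cancel, Units.val_one, mul_one]

theorem IsGammaParam.exists_matU (h : E.IsGammaParam ρ s) (h3 : 3 ∣ Nat.card ρ.range) :
    ∃ (ρ' : (L ≃ₐ[K] L) →* GL (Fin 2) (ZMod 3)) (s' : (Fin 2 → ZMod 3) → L),
      E.IsGammaParam ρ' s' ∧ matU ∈ matrices ρ'.range := by
  obtain ⟨A, hA, hA3, hA1⟩ := exists_order_three h3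
  obtain ⟨B, hB, hBA⟩ := exists_conj_matU A hA3 hA1
  exact h.exists_conj hA hB hBA

/-- By Cauchy and conjugation, the image would contain `matU`, which `IsGammaParam.rep_ne_unipotent`
excludes. -/
theorem IsGammaParam.not_three_dvd_card [CharZero K] (h : E.IsGammaParam ρ s)
    (hcube : ∃ d : K, d ^ 3 = E.Δ) : ¬ 3 ∣ Nat.card ρ.range := by
  have : CharZero L := charZero_of_injective_algebraMap (algebraMap K L).injective
  intro h3
  obtain ⟨ρ', s', h', hU⟩ := h.exists_matU h3
  obtain ⟨σ, hσ⟩ := mem_matrices_range.mp hU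
  exact h'.rep_ne_unipotent hcube σ hσ

/-! ### The four cases according to `μ₃` and cubes. -/

section Facts

variable [CharZero K] [E.gammaPoly.IsSplittingField K L] [FiniteDimensional K L] [IsGalois K L]

omit [E.gammaPoly.IsSplittingField K L] in
theorem IsGammaParam.exists_isPrimitiveRoot_iff_det (h : E.IsGammaParam ρ s) (hΔ : E.Δ ≠ 0) :
    (∃ ζ : K, IsPrimitiveRoot ζ 3) ↔ ∀ A ∈ matrices ρ.range, A.det = 1 := by
  rw [h.exists_isPrimitiveRoot_iff hΔ]
  constructor
  · intro hdet A hA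
    obtain ⟨σ, rfl⟩ := mem_matrices_range.mp hA
    exact hdet σ
  · exact fun hdet σ => hdet _ (mem_matrices_range.mpr ⟨σ, rfl⟩)

omit [E.gammaPoly.IsSplittingField K L] in
theorem IsGammaParam.exists_det_neg_one (h : E.IsGammaParam ρ s) (hΔ : E.Δ ≠ 0)
    (hμ : ¬ ∃ ζ : K, IsPrimitiveRoot ζ 3) : ∃ A ∈ matrices ρ.range, A.det = -1 := by
  rw [h.exists_isPrimitiveRoot_iff_det hΔ] at hμ
  push Not at hμ
  obtain ⟨A, hA, hdet⟩ := hμ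
  exact ⟨A, hA, (det_eq_of_mem hA).resolve_left hdet⟩

omit [CharZero K] [E.gammaPoly.IsSplittingField K L] in
theorem IsGammaParam.exists_mulVec_ne (h : E.IsGammaParam ρ s)
    (hroot : ∀ r : K, ¬ E.IsGammaRoot r) :
    ∃ A ∈ matrices ρ.range, A.mulVec ![1, 0] ≠ ![1, 0] := by
  by_contra! hfix
  obtain ⟨r, hr⟩ := h.exists_root_of_fixed (v := ![1, 0]) (by decide) fun σ =>
    hfix _ (mem_matrices_range.mpr ⟨σ, rfl⟩)
  exact hroot r hr

theorem IsGammaParam.of_isPrimitiveRoot_of_cube (h : E.IsGammaParam ρ s) (hΔ : E.Δ ≠ 0)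
    (hc₄ : E.c₄ ≠ 0) (hroot : ∀ r : K, ¬ E.IsGammaRoot r) (hμ : ∃ ζ : K, IsPrimitiveRoot ζ 3)
    (hcube : ∃ d : K, d ^ 3 = E.Δ) :
    (irreducibleFactorDegrees E.gammaPoly = {2, 2, 2, 2} ∧
      Nonempty ((L ≃ₐ[K] L) ≃* Multiplicative (ZMod 2))) ∨
    (irreducibleFactorDegrees E.gammaPoly = {4, 4} ∧
      Nonempty ((L ≃ₐ[K] L) ≃* Multiplicative (ZMod 4))) ∨
    (irreducibleFactorDegrees E.gammaPoly = {8} ∧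
      Nonempty ((L ≃ₐ[K] L) ≃* QuaternionGroup 2)) := by
  have hdet := (h.exists_isPrimitiveRoot_iff_det hΔ).mp hμ
  by_cases h4 : ∀ A ∈ matrices ρ.range, A * A ≠ -1
  · exact Or.inl (h.transfer hΔ hc₄ (of_det_one_of_forall (h.not_three_dvd_card hcube) hdet
      (h.exists_mulVec_ne hroot) h4))
  · push Not at h4
    obtain ⟨A, hA, hAA⟩ := h4
    obtain ⟨B, hB, hBA⟩ := exists_conj_matI A (hdet A hA) hAA
    obtain ⟨ρ', s', h', hI⟩ := h.exists_conj hA hB hBA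
    exact Or.inr ((of_det_one_of_matI (h'.not_three_dvd_card hcube)
      ((h'.exists_isPrimitiveRoot_iff_det hΔ).mp hμ) hI).imp (h'.transfer hΔ hc₄)
      (h'.transfer hΔ hc₄))

theorem IsGammaParam.of_isPrimitiveRoot_of_not_cube (h : E.IsGammaParam ρ s) (hΔ : E.Δ ≠ 0)
    (hc₄ : E.c₄ ≠ 0) (hμ : ∃ ζ : K, IsPrimitiveRoot ζ 3) (hcube : ¬ ∃ d : K, d ^ 3 = E.Δ) :
    (irreducibleFactorDegrees E.gammaPoly = {1, 1, 3, 3} ∧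
      Nonempty ((L ≃ₐ[K] L) ≃* Multiplicative (ZMod 3))) ∨
    (irreducibleFactorDegrees E.gammaPoly = {2, 6} ∧
      Nonempty ((L ≃ₐ[K] L) ≃* Multiplicative (ZMod 6))) ∨
    (irreducibleFactorDegrees E.gammaPoly = {8} ∧
      Nonempty ((L ≃ₐ[K] L) ≃* Matrix.SpecialLinearGroup (Fin 2) (ZMod 3))) := by
  obtain ⟨ρ', s', h', hU⟩ := h.exists_matU (h.natCard_range ▸ h.three_dvd_card hcube)
  exact (of_matU_of_det_one hU ((h'.exists_isPrimitiveRoot_iff_det hΔ).mp hμ)).imp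
    (h'.transfer hΔ hc₄) (Or.imp (h'.transfer hΔ hc₄) (h'.transfer hΔ hc₄))

theorem IsGammaParam.of_not_isPrimitiveRoot_of_cube (h : E.IsGammaParam ρ s) (hΔ : E.Δ ≠ 0)
    (hc₄ : E.c₄ ≠ 0) (hroot : ∀ r : K, ¬ E.IsGammaRoot r) (hμ : ¬ ∃ ζ : K, IsPrimitiveRoot ζ 3)
    (hcube : ∃ d : K, d ^ 3 = E.Δ) :
    (irreducibleFactorDegrees E.gammaPoly = {2, 2, 4} ∧
      Nonempty ((L ≃ₐ[K] L) ≃* Multiplicative (ZMod 2) × Multiplicative (ZMod 2))) ∨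
    (irreducibleFactorDegrees E.gammaPoly = {4, 4} ∧
      Nonempty ((L ≃ₐ[K] L) ≃* DihedralGroup 4)) ∨
    (irreducibleFactorDegrees E.gammaPoly = {8} ∧
      (Nonempty ((L ≃ₐ[K] L) ≃* Multiplicative (ZMod 8)) ∨
        ∃ P : Sylow 2 (GL (Fin 2) (ZMod 3)), Nonempty ((L ≃ₐ[K] L) ≃* P))) := by
  -- Quantifying over all parametrisations lets the negative case survive the later conjugation that
  -- produces `matS`.
  by_cases h8 : ∃ (ρ' : (L ≃ₐ[K] L) →* GL (Fin 2) (ZMod 3)) (s' : (Fin 2 → ZMod 3) → L),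
      E.IsGammaParam ρ' s' ∧ ∃ A ∈ matrices ρ'.range, A.det = -1 ∧ A * A ≠ 1
  · obtain ⟨ρ, s, h, A, hA, hdet, hAA⟩ := h8
    obtain ⟨B, hB, hBA⟩ := exists_conj_matR A hdet hAA
    obtain ⟨ρ', s', h', hR⟩ : ∃ (ρ' : (L ≃ₐ[K] L) →* GL (Fin 2) (ZMod 3))
        (s' : (Fin 2 → ZMod 3) → L), E.IsGammaParam ρ' s' ∧ matR ∈ matrices ρ'.range :=
      hBA.elim (h.exists_conj hA hB) (h.exists_conj (pow_mem hA 5) hB)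
    obtain ⟨ho, hiso⟩ := of_matR (h'.not_three_dvd_card hcube) hR
    refine Or.inr (Or.inr ⟨h'.irreducibleFactorDegrees_eq hΔ hc₄ ho, hiso.imp ?_ ?_⟩)
    · exact fun e => (h'.transfer hΔ hc₄ ⟨ho, e⟩).2
    · exact fun ⟨P, e⟩ => ⟨P, (h'.transfer hΔ hc₄ ⟨ho, e⟩).2⟩
  · push Not at h8
    obtain ⟨A, hA, hdet⟩ := h.exists_det_neg_one hΔ hμ
    obtain ⟨B, hB, hBA⟩ := exists_conj_matS A hdet (h8 ρ s h A hA hdet)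
    obtain ⟨ρ', s', h', hS⟩ := h.exists_conj hA hB hBA
    exact (of_matS (h'.not_three_dvd_card hcube) hS (h8 ρ' s' h') (h'.exists_mulVec_ne hroot)).imp
      (h'.transfer hΔ hc₄) fun h => Or.inl (h'.transfer hΔ hc₄ h)

theorem IsGammaParam.of_not_isPrimitiveRoot_of_not_cube (h : E.IsGammaParam ρ s) (hΔ : E.Δ ≠ 0)
    (hc₄ : E.c₄ ≠ 0) (hμ : ¬ ∃ ζ : K, IsPrimitiveRoot ζ 3) (hcube : ¬ ∃ d : K, d ^ 3 = E.Δ) :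
    (irreducibleFactorDegrees E.gammaPoly = {1, 1, 6} ∧
      Nonempty ((L ≃ₐ[K] L) ≃* DihedralGroup 3)) ∨
    (irreducibleFactorDegrees E.gammaPoly = {2, 3, 3} ∧
      Nonempty ((L ≃ₐ[K] L) ≃* DihedralGroup 3)) ∨
    (irreducibleFactorDegrees E.gammaPoly = {2, 6} ∧
      Nonempty ((L ≃ₐ[K] L) ≃* borelGL2F3)) ∨
    (irreducibleFactorDegrees E.gammaPoly = {8} ∧
      Nonempty ((L ≃ₐ[K] L) ≃* GL (Fin 2) (ZMod 3))) := by
  obtain ⟨ρ', s', h', hU⟩ := h.exists_matU (h.natCard_range ▸ h.three_dvd_card hcube)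
  obtain ⟨A, hA, hdet⟩ := h'.exists_det_neg_one hΔ hμ
  exact (of_matU_of_det_neg_one hU hA hdet).imp (h'.transfer hΔ hc₄)
    (Or.imp (h'.transfer hΔ hc₄) (Or.imp (h'.transfer hΔ hc₄) (h'.transfer hΔ hc₄)))

end Facts

end WeierstrassCurve

/-! ### The classification theorem. -/

theorem proposition3p1 {K : Type*} [Field K] [Algebra ℚ_[2] K] [Algebra ℤ_[2] K]
    [IsScalarTower ℤ_[2] ℚ_[2] K] [FiniteDimensional ℚ_[2] K]
    (E : WeierstrassCurve K) [E.IsElliptic]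
    (hadd : E.IsAdditive2) (hpot : E.IsPotentiallyGood2) (hc₄ : E.c₄ ≠ 0) :
    -- the action on `E[3]` embeds `G` in `GL(2, 𝔽₃)`
    (∃ (φ : E.threeTorsion E.threeDivisionField ≃+ (Fin 2 → ZMod 3))
        (ρ : E.threeDivisionGroup →* GL (Fin 2) (ZMod 3)),
      E.IsThreeTorsionRep φ ρ ∧ Function.Injective ρ) ∧
    -- `μ₃ ⊂ K` and `Δ` is a cube in `K`
    ((∃ ζ : K, IsPrimitiveRoot ζ 3) → (∃ d : K, d ^ 3 = E.Δ) →
      (irreducibleFactorDegrees E.gammaPoly = {2, 2, 2, 2} ∧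
        Nonempty (E.threeDivisionGroup ≃* Multiplicative (ZMod 2))) ∨
      (irreducibleFactorDegrees E.gammaPoly = {4, 4} ∧
        Nonempty (E.threeDivisionGroup ≃* Multiplicative (ZMod 4))) ∨
      (irreducibleFactorDegrees E.gammaPoly = {8} ∧
        Nonempty (E.threeDivisionGroup ≃* QuaternionGroup 2))) ∧
    -- `μ₃ ⊂ K` and `Δ` is not a cube in `K`
    ((∃ ζ : K, IsPrimitiveRoot ζ 3) → (¬ ∃ d : K, d ^ 3 = E.Δ) →
      (irreducibleFactorDegrees E.gammaPoly = {1, 1, 3, 3} ∧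
        Nonempty (E.threeDivisionGroup ≃* Multiplicative (ZMod 3))) ∨
      (irreducibleFactorDegrees E.gammaPoly = {2, 6} ∧
        Nonempty (E.threeDivisionGroup ≃* Multiplicative (ZMod 6))) ∨
      (irreducibleFactorDegrees E.gammaPoly = {8} ∧
        Nonempty (E.threeDivisionGroup ≃* Matrix.SpecialLinearGroup (Fin 2) (ZMod 3)))) ∧
    -- `μ₃ ⊄ K` and `Δ` is a cube in `K`
    ((¬ ∃ ζ : K, IsPrimitiveRoot ζ 3) → (∃ d : K, d ^ 3 = E.Δ) →
      (irreducibleFactorDegrees E.gammaPoly = {2, 2, 4} ∧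
        Nonempty (E.threeDivisionGroup ≃* Multiplicative (ZMod 2) × Multiplicative (ZMod 2))) ∨
      (irreducibleFactorDegrees E.gammaPoly = {4, 4} ∧
        Nonempty (E.threeDivisionGroup ≃* DihedralGroup 4)) ∨
      (irreducibleFactorDegrees E.gammaPoly = {8} ∧
        (Nonempty (E.threeDivisionGroup ≃* Multiplicative (ZMod 8)) ∨
          ∃ H : Sylow 2 (GL (Fin 2) (ZMod 3)), Nonempty (E.threeDivisionGroup ≃* H)))) ∧
    -- `μ₃ ⊄ K` and `Δ` is not a cube in `K`
    ((¬ ∃ ζ : K, IsPrimitiveRoot ζ 3) → (¬ ∃ d : K, d ^ 3 = E.Δ) →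
      (irreducibleFactorDegrees E.gammaPoly = {1, 1, 6} ∧
        Nonempty (E.threeDivisionGroup ≃* DihedralGroup 3)) ∨
      (irreducibleFactorDegrees E.gammaPoly = {2, 3, 3} ∧
        Nonempty (E.threeDivisionGroup ≃* DihedralGroup 3)) ∨
      (irreducibleFactorDegrees E.gammaPoly = {2, 6} ∧
        Nonempty (E.threeDivisionGroup ≃* borelGL2F3)) ∨
      (irreducibleFactorDegrees E.gammaPoly = {8} ∧
        Nonempty (E.threeDivisionGroup ≃* GL (Fin 2) (ZMod 3)))) := by
  have : CharZero K := charZero_of_injective_algebraMap (algebraMap ℚ_[2] K).injective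
  have hΔ : E.Δ ≠ 0 := E.isUnit_Δ.ne_zero
  have := WeierstrassCurve.isSplittingField_threeDivisionField hΔ hc₄
  have := WeierstrassCurve.finiteDimensional_threeDivisionField hΔ hc₄
  have := WeierstrassCurve.isGalois_threeDivisionField hΔ hc₄
  have : CharZero E.threeDivisionField :=
    charZero_of_injective_algebraMap (algebraMap K E.threeDivisionField).injective
  obtain ⟨φ⟩ := WeierstrassCurve.exists_coords
    (IsSplittingField.splits E.threeDivisionField E.gammaPoly) hΔ hc₄
  have h := WeierstrassCurve.isGammaParam_torsionRep hΔ hc₄ φ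
  refine ⟨⟨φ, WeierstrassCurve.torsionRep φ, fun σ P Q hQ => ?_, h.rep_injective⟩, ?_, ?_, ?_, ?_⟩
  · rw [WeierstrassCurve.torsionRep_mulVec]
    exact congrArg φ (Subtype.ext hQ)
  · exact fun hμ hcube => h.of_isPrimitiveRoot_of_cube hΔ hc₄
      (WeierstrassCurve.not_isGammaRoot_of_cube hadd hpot hΔ hc₄ hcube) hμ hcube
  · exact h.of_isPrimitiveRoot_of_not_cube hΔ hc₄
  · exact fun hμ hcube => h.of_not_isPrimitiveRoot_of_cube hΔ hc₄
      (WeierstrassCurve.not_isGammaRoot_of_cube hadd hpot hΔ hc₄ hcube) hμ hcube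
  · exact h.of_not_isPrimitiveRoot_of_not_cube hΔ hc₄
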